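/- Let $n\ge 2$ and let $\Omega\subset\mathbb R^n$ be a nonempty bounded open set with smooth boundary. Let $w\in C^\infty(\overline\Omega)$ satisfy $w>0$ in $\Omega$ and $w=\Delta w=0$ on $\partial\Omega$, and set $z:=-\Delta w+w$ and $f:=-\Delta z+z$ in $\Omega$. For an open set $U\subset\Omega$ let $u_U$ denote the weak solution, extended by zero outside $U$, of the simply supported biharmonic problem $$\Delta^2u_U=f\ \text{ in } H^{-1}(U),\qquad \Delta u_U\in H^1_0(U),\qquad u_U\in H^1_0(U);$$ that is, $u_U\in H^1_0(U)$ and there is $v\in H^1_0(U)$ with $-\int_U\nabla u_U\cdot\nabla\varphi\,dx=\int_U v\varphi\,dx$ and $-\int_U\nabla v\cdot\nabla\varphi\,dx=\int_U f\varphi\,dx$ for all $\varphi\in H^1_0(U)$. Put $J(U):=\int_\Omega j(x,u_U(x))\,dx$ with $j(x,s):=(s-w(x))^2$. Then: 1. for every open $U\subset\Omega$ the solution $u_U$ exists and is unique (up to null sets), and $J(U)=0$ if and only if $u_U=w$ a.e. in $\Omega$; 2. for no open $U\subset\Omega$ is $u_U=w$ a.e. in $\Omega$; 3. $\inf\{J(U):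 U\subset\Omega\text{ open}\}=0$, and the infimum is not attained: the problem of minimizing $J$ over all open subsets $U$ of $\Omega$ has no optimal domain. -/

import Mathlib

open MeasureTheory Filter Topology Set
open scoped ContDiff ENNReal Laplacian

noncomputable section

namespace SimplySupported

/-- `φ ∈ C_c^∞(U)`. -/
def IsTestFunction {n : ℕ} (U : Set (EuclideanSpace ℝ (Fin n)))
    (φ : EuclideanSpace ℝ (Fin n) → ℝ) : Prop :=
  ContDiff ℝ ∞ φ ∧ HasCompactSupport φ ∧ tsupport φ ⊆ U

/-- `u ∈ H¹₀(U)`, extended by zero to the whole space, with weak gradient `G`: the pair `(u, G)` is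
the limit in `L² × L²` of pairs `(φₖ, ∇φₖ)` with `φₖ ∈ C_c^∞(U)`. So `H¹₀(U)` is the closure of
`C_c^∞(U)` for the `H¹` norm, and `G` is determined by `u` up to a null set. -/
def InH10 {n : ℕ} (U : Set (EuclideanSpace ℝ (Fin n))) (u : EuclideanSpace ℝ (Fin n) → ℝ)
    (G : EuclideanSpace ℝ (Fin n) → EuclideanSpace ℝ (Fin n)) : Prop :=
  MemLp u 2 volume ∧ MemLp G 2 volume ∧
    ∃ φ : ℕ → EuclideanSpace ℝ (Fin n) → ℝ, (∀ k, IsTestFunction U (φ k)) ∧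
      Tendsto (fun k => eLpNorm (fun x => φ k x - u x) 2 volume) atTop (𝓝 0) ∧
      Tendsto (fun k => eLpNorm (fun x => gradient (φ k) x - G x) 2 volume) atTop (𝓝 0)

/-- `Δu = h` in `H⁻¹(U)`, where `G` is the weak gradient of `u`: an equality of functionals on
`H¹₀(U)`, with `⟨Δu, φ⟩ = -∫_U ∇u · ∇φ` and `⟨h, φ⟩ = ∫_U h φ`. -/
def LaplacianEq {n : ℕ} (U : Set (EuclideanSpace ℝ (Fin n)))
    (G : EuclideanSpace ℝ (Fin n) → EuclideanSpace ℝ (Fin n))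
    (h : EuclideanSpace ℝ (Fin n) → ℝ) : Prop :=
  ∀ (φ : EuclideanSpace ℝ (Fin n) → ℝ) (Gφ : EuclideanSpace ℝ (Fin n) → EuclideanSpace ℝ (Fin n)),
    InH10 U φ Gφ → -(∫ x in U, inner ℝ (G x) (Gφ x)) = ∫ x in U, h x * φ x

/-- `u` is a weak solution of the simply supported biharmonic problem on `U`:
`u ∈ H¹₀(U)`, `Δu ∈ H¹₀(U)` (the function `v`), and `Δ(Δu) = f` in `H⁻¹(U)`. -/
def IsSolution {n : ℕ} (U : Set (EuclideanSpace ℝ (Fin n))) (f u : EuclideanSpace ℝ (Fin n) → ℝ) :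
    Prop :=
  ∃ (Gu : EuclideanSpace ℝ (Fin n) → EuclideanSpace ℝ (Fin n))
    (v : EuclideanSpace ℝ (Fin n) → ℝ)
    (Gv : EuclideanSpace ℝ (Fin n) → EuclideanSpace ℝ (Fin n)),
    InH10 U u Gu ∧ InH10 U v Gv ∧ LaplacianEq U Gu v ∧ LaplacianEq U Gv f

/-- The cost `∫_Ω j(x, u(x)) dx`. -/
def cost {n : ℕ} (Ω : Set (EuclideanSpace ℝ (Fin n))) (j : EuclideanSpace ℝ (Fin n) → ℝ → ℝ)
    (u : EuclideanSpace ℝ (Fin n) → ℝ) : ℝ :=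
  ∫ x in Ω, j x (u x)

/-- The set of all values `∫_Ω j(x, u_U(x)) dx`, for `U ⊆ Ω` open. -/
def costValues {n : ℕ} (Ω : Set (EuclideanSpace ℝ (Fin n))) (f : EuclideanSpace ℝ (Fin n) → ℝ)
    (j : EuclideanSpace ℝ (Fin n) → ℝ → ℝ) : Set ℝ :=
  {c | ∃ (U : Set (EuclideanSpace ℝ (Fin n))) (u : EuclideanSpace ℝ (Fin n) → ℝ),
    IsOpen U ∧ U ⊆ Ω ∧ IsSolution U f u ∧ c = cost Ω j u}

/-- `U` attains the minimum of `∫_Ω j(x, u_U(x)) dx` among all open subsets of `Ω`. -/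
def IsOptimalDomain {n : ℕ} (Ω : Set (EuclideanSpace ℝ (Fin n)))
    (f : EuclideanSpace ℝ (Fin n) → ℝ) (j : EuclideanSpace ℝ (Fin n) → ℝ → ℝ)
    (U : Set (EuclideanSpace ℝ (Fin n))) : Prop :=
  IsOpen U ∧ U ⊆ Ω ∧ ∃ u, IsSolution U f u ∧ ∀ c ∈ costValues Ω f j, cost Ω j u ≤ c

/-- `∂Ω` is smooth: near each boundary point, `Ω` is the sublevel set `{ρ < 0}` of a smooth function
`ρ` with nonvanishing differential at that point. -/
def HasSmoothBoundary {n : ℕ} (Ω : Set (EuclideanSpace ℝ (Fin n))) : Prop :=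
  ∀ y ∈ frontier Ω, ∃ (V : Set (EuclideanSpace ℝ (Fin n))) (ρ : EuclideanSpace ℝ (Fin n) → ℝ),
    IsOpen V ∧ y ∈ V ∧ ContDiffOn ℝ ∞ ρ V ∧ fderiv ℝ ρ y ≠ 0 ∧ Ω ∩ V = {x | ρ x < 0} ∩ V

/-- `w ∈ C^∞(closure Ω)` for an open set `Ω`: `w` is smooth in `Ω`, continuous on the closure, and
all its derivatives extend continuously from `Ω` to the closure. -/
def SmoothUpToBoundary {n : ℕ} (Ω : Set (EuclideanSpace ℝ (Fin n)))
    (w : EuclideanSpace ℝ (Fin n) → ℝ) : Prop :=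
  ContDiffOn ℝ ∞ w Ω ∧ ContinuousOn w (closure Ω) ∧
    ∀ k : ℕ, ∃ F : EuclideanSpace ℝ (Fin n) →
        ContinuousMultilinearMap ℝ (fun _ : Fin k => EuclideanSpace ℝ (Fin n)) ℝ,
      ContinuousOn F (closure Ω) ∧ EqOn (iteratedFDeriv ℝ k w) F Ω

/-- `(-Δ + 1) w`, with the classical Laplacian. -/
def negLaplacianAddOne {n : ℕ} (w : EuclideanSpace ℝ (Fin n) → ℝ) :
    EuclideanSpace ℝ (Fin n) → ℝ :=
  fun x => -(Δ w) x + w x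

end SimplySupported

end

noncomputable section

namespace SimplySupported

variable {n : ℕ}

/-! Homogenization: on a domain perforated by suitable small holes, the Dirichlet problem for `-Δ`
is close in L² to the problem for `-Δ + 1` on `Ω` (the "strange term" of Cioranescu and Murat). The
simply supported problem splits into the Dirichlet problems `-Δ(-v) = f` and `-Δu = -v`. Since `(-Δ
+ 1)z = f` and `(-Δ + 1)w = z`, a well chosen perforation makes `-v` close to `z`, hence `u` close
to `w`, and the infimum of the cost is zero.

The closeness is quantitative (`IsCorrector.norm_sub_le`). Let `θ` satisfy `Δθ = -1` on `U` and
vanish on the boundaries of the holes. For smooth `h` vanishing on `∂Ω`, the product `θh` lies in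
H¹₀(U) and `-Δ(θh) = (-Δh + h) + (θ - 1)Δh - 2 div((θ - 1)∇h)`. The last two terms are small as soon
as `θ - 1` is small in L², so the energy estimate finishes the comparison. No bound on `∇θ` enters
the constant.

Such `θ` come from logarithmic potentials in a coordinate plane (`exists_isCorrector`). The mean of
`log |ζ - p|` over `p` in a disc of radius `R` is a quadratic function of `ζ` with Laplacian `2/R²`.
By Hahn-Banach it is an L² limit of finite convex combinations of the functions `log |ζ - pᵢ|`
(`discPotential_mem_closure`). Adding to 1 the error of such an approximation, multiplied by `R²/2`,
gives Laplacian `-1` off the poles. The holes are where the result is nonpositive; positive weights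
make them contain neighbourhoods of the poles.

The infimum is not attained (`not_ae_eq_of_isSolution`). If `u_U = w`, then `U` fills `Ω` up to a
null set, because `w > 0` and `u_U = 0` off `U`. Comparing `Δ²w = f` with `f = (-Δ + 1)²w` yields `w
= 2Δw` in `Ω`, which is impossible at an interior maximum, where `w > 0` and `Δw ≤ 0`. -/

/-- Scalar square integrable functions on `ℝⁿ`. -/
abbrev ScalarL2 (n : ℕ) := Lp ℝ 2 (volume : Measure (EuclideanSpace ℝ (Fin n)))

/-- Square integrable vector fields on `ℝⁿ`. -/
abbrev VectorL2 (n : ℕ) :=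
  Lp (EuclideanSpace ℝ (Fin n)) 2 (volume : Measure (EuclideanSpace ℝ (Fin n)))

/-- Pairs of a function and a vector field, both square integrable. -/
abbrev PairL2 (n : ℕ) := WithLp 2 (ScalarL2 n × VectorL2 n)

/-! ### Test functions and their gradients. -/

section TestFunctions

variable {U : Set (EuclideanSpace ℝ (Fin n))} {φ ψ : EuclideanSpace ℝ (Fin n) → ℝ}

lemma isTestFunction_zero : IsTestFunction U (0 : EuclideanSpace ℝ (Fin n) → ℝ) :=
  ⟨contDiff_const, HasCompactSupport.zero, by simp [tsupport]⟩

lemma IsTestFunction.add (hφ : IsTestFunction U φ) (hψ : IsTestFunction U ψ) :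
    IsTestFunction U (φ + ψ) :=
  ⟨hφ.1.add hψ.1, hφ.2.1.add hψ.2.1,
    (tsupport_add φ ψ).trans (union_subset hφ.2.2 hψ.2.2)⟩

lemma IsTestFunction.const_smul (c : ℝ) (hφ : IsTestFunction U φ) : IsTestFunction U (c • φ) :=
  ⟨hφ.1.const_smul c, hφ.2.1.smul_left (f := fun _ => c),
    (tsupport_smul_subset_right (fun _ => c) φ).trans hφ.2.2⟩

lemma IsTestFunction.differentiable (hφ : IsTestFunction U φ) : Differentiable ℝ φ :=
  hφ.1.differentiable (by simp)

lemma IsTestFunction.fderiv_apply (hφ : IsTestFunction U φ) (v : EuclideanSpace ℝ (Fin n)) :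
    IsTestFunction U (fun x => fderiv ℝ φ x v) := by
  refine ⟨(hφ.1.fderiv_right (m := ∞) (by simp)).clm_apply contDiff_const,
    hφ.2.1.fderiv_apply ℝ v, (tsupport_fderiv_apply_subset ℝ v).trans hφ.2.2⟩

lemma IsTestFunction.continuous_gradient (hφ : IsTestFunction U φ) : Continuous (gradient φ) :=
  (InnerProductSpace.toDual ℝ _).symm.continuous.comp (hφ.1.continuous_fderiv (by simp))

lemma IsTestFunction.hasCompactSupport_gradient (hφ : IsTestFunction U φ) :
    HasCompactSupport (gradient φ) :=
  (hφ.2.1.fderiv ℝ).comp_left (map_zero (InnerProductSpace.toDual ℝ _).symm)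

lemma IsTestFunction.memLp (hφ : IsTestFunction U φ) {p : ℝ≥0∞} : MemLp φ p volume :=
  hφ.1.continuous.memLp_of_hasCompactSupport hφ.2.1

lemma IsTestFunction.memLp_gradient (hφ : IsTestFunction U φ) {p : ℝ≥0∞} :
    MemLp (gradient φ) p volume :=
  hφ.continuous_gradient.memLp_of_hasCompactSupport hφ.hasCompactSupport_gradient

lemma IsTestFunction.eq_zero_of_notMem (hφ : IsTestFunction U φ) {x : EuclideanSpace ℝ (Fin n)}
    (hx : x ∉ U) : φ x = 0 :=
  image_eq_zero_of_notMem_tsupport fun h => hx (hφ.2.2 h)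

lemma IsTestFunction.fderiv_eq_zero_of_notMem (hφ : IsTestFunction U φ)
    {x : EuclideanSpace ℝ (Fin n)} (hx : x ∉ U) : fderiv ℝ φ x = 0 :=
  image_eq_zero_of_notMem_tsupport fun h => hx (hφ.2.2 (tsupport_fderiv_subset ℝ h))

lemma IsTestFunction.gradient_eq_zero_of_notMem (hφ : IsTestFunction U φ)
    {x : EuclideanSpace ℝ (Fin n)} (hx : x ∉ U) : gradient φ x = 0 := by
  simp [gradient, hφ.fderiv_eq_zero_of_notMem hx]

lemma gradient_add_of_differentiable (hφ : Differentiable ℝ φ) (hψ : Differentiable ℝ ψ) :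
    gradient (φ + ψ) = gradient φ + gradient ψ := by
  ext1 x
  simp [gradient, fderiv_add (hφ x) (hψ x)]

lemma gradient_const_smul_of_differentiable (c : ℝ) (hφ : Differentiable ℝ φ) :
    gradient (c • φ) = c • gradient φ := by
  ext1 x
  simp [gradient, fderiv_const_smul (hφ x) c]

end TestFunctions

/-! ### H¹₀(U) as a Hilbert space. -/

/-- The pairs `(φ, ∇φ)` with `φ ∈ C_c^∞(U)`. -/
def testPairs (U : Set (EuclideanSpace ℝ (Fin n))) : Submodule ℝ (PairL2 n) where
  carrier := {p | ∃ φ, IsTestFunction U φ ∧ p.fst =ᵐ[volume] φ ∧ p.snd =ᵐ[volume] gradient φ}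
  zero_mem' := by
    refine ⟨0, isTestFunction_zero, Lp.coeFn_zero _ _ _, (Lp.coeFn_zero _ _ _).trans ?_⟩
    filter_upwards with x
    simp [gradient]
  add_mem' := by
    rintro p q ⟨φ, hφ, h1, h2⟩ ⟨ψ, hψ, h3, h4⟩
    refine ⟨φ + ψ, hφ.add hψ, (Lp.coeFn_add _ _).trans (h1.add h3), ?_⟩
    rw [gradient_add_of_differentiable hφ.differentiable hψ.differentiable]
    exact (Lp.coeFn_add _ _).trans (h2.add h4)
  smul_mem' := by
    rintro c p ⟨φ, hφ, h1, h2⟩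
    refine ⟨c • φ, hφ.const_smul c, (Lp.coeFn_smul _ _).trans (h1.const_smul c), ?_⟩
    rw [gradient_const_smul_of_differentiable c hφ.differentiable]
    exact (Lp.coeFn_smul _ _).trans (h2.const_smul c)

/-- `H¹₀(U)` as a closed subspace of `L² × L²`. -/
def H10 (U : Set (EuclideanSpace ℝ (Fin n))) : Submodule ℝ (PairL2 n) :=
  (testPairs U).topologicalClosure

instance (U : Set (EuclideanSpace ℝ (Fin n))) : CompleteSpace (H10 U) :=
  (testPairs U).isClosed_topologicalClosure.completeSpace_coe

/-- The pair of `L²` classes of a function and a vector field. -/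
def mkPair {u : EuclideanSpace ℝ (Fin n) → ℝ}
    {G : EuclideanSpace ℝ (Fin n) → EuclideanSpace ℝ (Fin n)}
    (hu : MemLp u 2 volume) (hG : MemLp G 2 volume) : PairL2 n :=
  WithLp.toLp 2 (hu.toLp u, hG.toLp G)

lemma mkPair_fst_ae {u : EuclideanSpace ℝ (Fin n) → ℝ}
    {G : EuclideanSpace ℝ (Fin n) → EuclideanSpace ℝ (Fin n)}
    (hu : MemLp u 2 volume) (hG : MemLp G 2 volume) : (mkPair hu hG).fst =ᵐ[volume] u :=
  MemLp.coeFn_toLp hu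

lemma mkPair_snd_ae {u : EuclideanSpace ℝ (Fin n) → ℝ}
    {G : EuclideanSpace ℝ (Fin n) → EuclideanSpace ℝ (Fin n)}
    (hu : MemLp u 2 volume) (hG : MemLp G 2 volume) : (mkPair hu hG).snd =ᵐ[volume] G :=
  MemLp.coeFn_toLp hG

lemma continuous_fst : Continuous (fun p : PairL2 n => p.fst) :=
  (WithLp.fstL 2 ℝ (ScalarL2 n) (VectorL2 n)).continuous

lemma continuous_snd : Continuous (fun p : PairL2 n => p.snd) :=
  (WithLp.sndL 2 ℝ (ScalarL2 n) (VectorL2 n)).continuous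

lemma tendsto_pairL2_iff {p : ℕ → PairL2 n} {q : PairL2 n} :
    Tendsto p atTop (𝓝 q) ↔
      Tendsto (fun k => (p k).fst) atTop (𝓝 q.fst) ∧
        Tendsto (fun k => (p k).snd) atTop (𝓝 q.snd) := by
  constructor
  · intro h
    exact ⟨(continuous_fst.tendsto q).comp h, (continuous_snd.tendsto q).comp h⟩
  · rintro ⟨h1, h2⟩
    exact ((WithLp.prodContinuousLinearEquiv 2 ℝ (ScalarL2 n) (VectorL2 n)).symm.continuous.tendsto
      (q.fst, q.snd)).comp (h1.prodMk_nhds h2)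

lemma IsTestFunction.mkPair_mem {U : Set (EuclideanSpace ℝ (Fin n))}
    {φ : EuclideanSpace ℝ (Fin n) → ℝ} (hφ : IsTestFunction U φ) :
    mkPair hφ.memLp hφ.memLp_gradient ∈ testPairs U :=
  ⟨φ, hφ, mkPair_fst_ae _ _, mkPair_snd_ae _ _⟩

lemma testPairs_le_H10 (U : Set (EuclideanSpace ℝ (Fin n))) : testPairs U ≤ H10 U :=
  Submodule.le_topologicalClosure _

/-- A closed condition on `H¹₀(U)` may be checked on test functions. -/
lemma H10_induction {U : Set (EuclideanSpace ℝ (Fin n))} {P : PairL2 n → Prop}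
    (hP : IsClosed {p | P p})
    (h : ∀ φ (hφ : IsTestFunction U φ), P (mkPair hφ.memLp hφ.memLp_gradient))
    {p : PairL2 n} (hp : p ∈ H10 U) : P p := by
  have : (testPairs U : Set (PairL2 n)) ⊆ {p | P p} := by
    rintro q ⟨φ, hφ, h1, h2⟩
    have : q = mkPair hφ.memLp hφ.memLp_gradient := by
      refine (WithLp.ofLp_injective 2) (Prod.ext ?_ ?_)
      · exact Lp.ext (h1.trans (mkPair_fst_ae _ _).symm)
      · exact Lp.ext (h2.trans (mkPair_snd_ae _ _).symm)
    rw [this]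
    exact h φ hφ
  exact closure_minimal this hP hp

/-- In a metric space, closure is sequential closure. This links the definition by approximating
sequences with the closed subspace on which Hilbert space methods act. -/
lemma inH10_iff {U : Set (EuclideanSpace ℝ (Fin n))} {u : EuclideanSpace ℝ (Fin n) → ℝ}
    {G : EuclideanSpace ℝ (Fin n) → EuclideanSpace ℝ (Fin n)} :
    InH10 U u G ↔ ∃ p ∈ H10 U, p.fst =ᵐ[volume] u ∧ p.snd =ᵐ[volume] G := by
  constructor
  · rintro ⟨hu, hG, φ, hφ, h1, h2⟩
    refine ⟨mkPair hu hG, ?_, mkPair_fst_ae _ _, mkPair_snd_ae _ _⟩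
    refine mem_closure_of_tendsto (b := atTop)
      (f := fun k => mkPair (hφ k).memLp (hφ k).memLp_gradient) ?_
      (Eventually.of_forall fun k => (hφ k).mkPair_mem)
    rw [tendsto_pairL2_iff]
    exact ⟨(Lp.tendsto_Lp_iff_tendsto_eLpNorm'' _ (fun k => (hφ k).memLp) _ hu).2 h1,
      (Lp.tendsto_Lp_iff_tendsto_eLpNorm'' _ (fun k => (hφ k).memLp_gradient) _ hG).2 h2⟩
  · rintro ⟨p, hp, h1, h2⟩
    obtain ⟨q, hq, hqp⟩ := mem_closure_iff_seq_limit.1 hp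
    choose φ hφ h3 h4 using hq
    rw [tendsto_pairL2_iff, Lp.tendsto_Lp_iff_tendsto_eLpNorm',
      Lp.tendsto_Lp_iff_tendsto_eLpNorm'] at hqp
    refine ⟨(memLp_congr_ae h1).1 (Lp.memLp _), (memLp_congr_ae h2).1 (Lp.memLp _), φ, hφ, ?_, ?_⟩
    · refine hqp.1.congr fun k => eLpNorm_congr_ae ?_
      exact (h3 k).sub h1
    · refine hqp.2.congr fun k => eLpNorm_congr_ae ?_
      exact (h4 k).sub h2

lemma inH10_of_mem {U : Set (EuclideanSpace ℝ (Fin n))} {p : PairL2 n} (hp : p ∈ H10 U) :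
    InH10 U p.fst p.snd :=
  inH10_iff.2 ⟨p, hp, EventuallyEq.rfl, EventuallyEq.rfl⟩

/-- The set is the kernel of the continuous restriction map from L² to L²(s). -/
lemma isClosed_ae_eq_zero_on {F : Type*} [NormedAddCommGroup F] [NormedSpace ℝ F]
    (s : Set (EuclideanSpace ℝ (Fin n))) :
    IsClosed {f : Lp F 2 (volume : Measure (EuclideanSpace ℝ (Fin n))) |
      f =ᵐ[volume.restrict s] 0} := by
  have : {f : Lp F 2 (volume : Measure (EuclideanSpace ℝ (Fin n))) | f =ᵐ[volume.restrict s] 0} =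
      (LpToLpRestrictCLM _ F ℝ volume 2 s) ⁻¹' {0} := by
    ext f
    simp only [Set.mem_ofPred_eq, mem_preimage, mem_singleton_iff, Lp.eq_zero_iff_ae_eq_zero]
    have := LpToLpRestrictCLM_coeFn ℝ s f
    exact ⟨fun h => this.trans h, fun h => this.symm.trans h⟩
  rw [this]
  exact isClosed_singleton.preimage (ContinuousLinearMap.continuous _)

/-- Elements of `H¹₀(U)` vanish outside `U`, as do their gradients. -/
lemma ae_eq_zero_of_mem_H10 {U : Set (EuclideanSpace ℝ (Fin n))} (hU : MeasurableSet U)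
    {p : PairL2 n} (hp : p ∈ H10 U) :
    p.fst =ᵐ[volume.restrict Uᶜ] 0 ∧ p.snd =ᵐ[volume.restrict Uᶜ] 0 := by
  refine H10_induction (P := fun p : PairL2 n =>
    p.fst =ᵐ[volume.restrict Uᶜ] 0 ∧ p.snd =ᵐ[volume.restrict Uᶜ] 0) ?_ ?_ hp
  · exact ((isClosed_ae_eq_zero_on Uᶜ).preimage continuous_fst).inter
      ((isClosed_ae_eq_zero_on Uᶜ).preimage continuous_snd)
  · intro φ hφ
    constructor
    · refine EventuallyEq.trans (ae_restrict_of_ae (mkPair_fst_ae hφ.memLp hφ.memLp_gradient)) ?_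
      filter_upwards [ae_restrict_mem hU.compl] with x hx using hφ.eq_zero_of_notMem hx
    · refine EventuallyEq.trans (ae_restrict_of_ae (mkPair_snd_ae hφ.memLp hφ.memLp_gradient)) ?_
      filter_upwards [ae_restrict_mem hU.compl] with x hx using hφ.gradient_eq_zero_of_notMem hx

/-! ### Green's formulas against test functions. -/

section IntegrationByParts

variable {U : Set (EuclideanSpace ℝ (Fin n))} {φ a b q : EuclideanSpace ℝ (Fin n) → ℝ}

/-- Smoothness holds on the whole space although `q` is controlled only in `U`: near a point outside
`U` the factor `φ` is identically zero. -/
lemma IsTestFunction.mul_contDiffOn (hφ : IsTestFunction U φ) (hU : IsOpen U)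
    (hq : ContDiffOn ℝ ∞ q U) : IsTestFunction U (fun x => φ x * q x) := by
  refine ⟨contDiff_iff_contDiffAt.2 fun x => ?_, hφ.2.1.mul_right,
    (tsupport_mul_subset_left).trans hφ.2.2⟩
  by_cases hx : x ∈ U
  · exact hφ.1.contDiffAt.mul (hq.contDiffAt (hU.mem_nhds hx))
  · have h0 : φ =ᶠ[𝓝 x] 0 := notMem_tsupport_iff_eventuallyEq.1 fun h => hx (hφ.2.2 h)
    refine (contDiffAt_const (c := (0 : ℝ))).congr_of_eventuallyEq ?_
    filter_upwards [h0] with y hy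
    simp [hy]

lemma IsTestFunction.integrable_mul (hφ : IsTestFunction U φ) (hU : IsOpen U)
    (hq : ContinuousOn q U) : Integrable (fun x => φ x * q x) volume := by
  refine Continuous.integrable_of_hasCompactSupport ?_ hφ.2.1.mul_right
  refine continuous_iff_continuousAt.2 fun x => ?_
  by_cases hx : x ∈ U
  · exact hφ.1.continuous.continuousAt.mul (hq.continuousAt (hU.mem_nhds hx))
  · have h0 : φ =ᶠ[𝓝 x] 0 := notMem_tsupport_iff_eventuallyEq.1 fun h => hx (hφ.2.2 h)
    refine (continuousAt_const (y := (0 : ℝ))).congr ?_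
    filter_upwards [h0] with y hy
    simp [hy]

lemma IsTestFunction.integral_fderiv_eq_zero (hφ : IsTestFunction U φ)
    (v : EuclideanSpace ℝ (Fin n)) : ∫ x, fderiv ℝ φ x v = 0 := by
  have := integral_mul_fderiv_eq_neg_fderiv_mul_of_integrable (μ := volume)
    (f := fun _ : EuclideanSpace ℝ (Fin n) => (1 : ℝ)) (g := φ) (v := v)
    (by simp) (by simpa using (memLp_one_iff_integrable.1 (hφ.fderiv_apply v).memLp))
    (by simpa using (memLp_one_iff_integrable.1 hφ.memLp)) (fun _ _ => by fun_prop)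
    (fun x _ => hφ.differentiable x)
  simpa using this

lemma IsTestFunction.fderiv_mul_apply (hφ : IsTestFunction U φ) (hU : IsOpen U)
    (hq : ContDiffOn ℝ ∞ q U) {x : EuclideanSpace ℝ (Fin n)} (hx : x ∈ U)
    (v : EuclideanSpace ℝ (Fin n)) :
    fderiv ℝ (fun y => φ y * q y) x v = fderiv ℝ q x v * φ x + q x * fderiv ℝ φ x v := by
  have hqx : DifferentiableAt ℝ q x :=
    (hq.contDiffAt (hU.mem_nhds hx)).differentiableAt (by simp)
  rw [fderiv_fun_mul (hφ.differentiable x) hqx]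
  simp only [add_apply, smul_apply, smul_eq_mul]
  ring

lemma IsTestFunction.integrableOn_fderiv_mul (hφ : IsTestFunction U φ) (hU : IsOpen U)
    (hq : ContDiffOn ℝ ∞ q U) (v : EuclideanSpace ℝ (Fin n)) :
    IntegrableOn (fun x => fderiv ℝ q x v * φ x + q x * fderiv ℝ φ x v) U volume := by
  have h := (memLp_one_iff_integrable.1 ((hφ.mul_contDiffOn hU hq).fderiv_apply v).memLp).integrableOn
    (s := U)
  exact h.congr_fun (fun x hx => hφ.fderiv_mul_apply hU hq hx v) hU.measurableSet

lemma IsTestFunction.setIntegral_fderiv_mul (hφ : IsTestFunction U φ) (hU : IsOpen U)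
    (hq : ContDiffOn ℝ ∞ q U) (v : EuclideanSpace ℝ (Fin n)) :
    ∫ x in U, (fderiv ℝ q x v * φ x + q x * fderiv ℝ φ x v) = 0 := by
  have hψ := hφ.mul_contDiffOn hU hq
  have h : ∫ x in U, fderiv ℝ (fun y => φ y * q y) x v = 0 := by
    rw [setIntegral_eq_integral_of_forall_compl_eq_zero (fun x hx => by
      rw [hψ.fderiv_eq_zero_of_notMem hx, zero_apply])]
    exact hψ.integral_fderiv_eq_zero v
  rw [← h]
  exact setIntegral_congr_fun hU.measurableSet fun x hx => (hφ.fderiv_mul_apply hU hq hx v).symm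

lemma inner_gradient_eq_sum (a b : EuclideanSpace ℝ (Fin n) → ℝ) (x : EuclideanSpace ℝ (Fin n)) :
    inner ℝ (gradient a x) (gradient b x) =
      ∑ i, fderiv ℝ a x (EuclideanSpace.single i 1) * fderiv ℝ b x (EuclideanSpace.single i 1) := by
  rw [← (EuclideanSpace.basisFun (Fin n) ℝ).sum_inner_mul_inner]
  refine Finset.sum_congr rfl fun i _ => ?_
  rw [EuclideanSpace.basisFun_apply, inner_gradient_left, real_inner_comm, inner_gradient_left]

lemma contDiffOn_fderiv_apply (hU : IsOpen U) (hb : ContDiffOn ℝ ∞ b U)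
    (v : EuclideanSpace ℝ (Fin n)) : ContDiffOn ℝ ∞ (fun x => fderiv ℝ b x v) U :=
  (hb.fderiv_of_isOpen hU (m := ∞) (by simp)).clm_apply contDiffOn_const

lemma laplacian_eq_sum (hU : IsOpen U) (hb : ContDiffOn ℝ ∞ b U)
    {x : EuclideanSpace ℝ (Fin n)} (hx : x ∈ U) :
    (Δ b) x = ∑ i, fderiv ℝ (fun y => fderiv ℝ b y (EuclideanSpace.single i 1)) x
      (EuclideanSpace.single i 1) := by
  rw [InnerProductSpace.laplacian_eq_iteratedFDeriv_orthonormalBasis b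
    (EuclideanSpace.basisFun (Fin n) ℝ)]
  refine Finset.sum_congr rfl fun i _ => ?_
  have hd : DifferentiableAt ℝ (fderiv ℝ b) x :=
    ((hb.fderiv_of_isOpen hU (m := ∞) (by simp)).contDiffAt (hU.mem_nhds hx)).differentiableAt
      (by simp)
  rw [iteratedFDeriv_two_apply, fderiv_clm_apply hd (by fun_prop)]
  simp

lemma contDiffOn_laplacian (hU : IsOpen U) (hb : ContDiffOn ℝ ∞ b U) :
    ContDiffOn ℝ ∞ (Δ b) U := by
  refine ContDiffOn.congr ?_ (fun x hx => laplacian_eq_sum hU hb hx)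
  exact ContDiffOn.sum fun i _ =>
    contDiffOn_fderiv_apply hU (contDiffOn_fderiv_apply hU hb _) _

lemma continuousOn_gradient (hU : IsOpen U) (hb : ContDiffOn ℝ ∞ b U) :
    ContinuousOn (gradient b) U :=
  (InnerProductSpace.toDual ℝ _).symm.continuous.comp_continuousOn
    (hb.continuousOn_fderiv_of_isOpen hU (by simp))

/-- Both sides expand `div(φ a ∇b)`; each term on the left integrates to zero, which gives Green's
formula with weight `a`. -/
lemma sum_fderiv_mul_eq (hU : IsOpen U)
    (ha : ContDiffOn ℝ ∞ a U) (hb : ContDiffOn ℝ ∞ b U) {x : EuclideanSpace ℝ (Fin n)}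
    (hx : x ∈ U) :
    ∑ i, (fderiv ℝ (fun x => a x * fderiv ℝ b x (EuclideanSpace.single i 1)) x
        (EuclideanSpace.single i 1) * φ x +
      a x * fderiv ℝ b x (EuclideanSpace.single i 1) *
        fderiv ℝ φ x (EuclideanSpace.single i 1)) =
    a x * inner ℝ (gradient b x) (gradient φ x) +
      (a x * (Δ b) x + inner ℝ (gradient a x) (gradient b x)) * φ x := by
  simp only [inner_gradient_eq_sum, laplacian_eq_sum hU hb hx, Finset.mul_sum, Finset.sum_mul,
    ← Finset.sum_add_distrib]
  refine Finset.sum_congr rfl fun i _ => ?_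
  rw [fderiv_fun_mul ((ha.contDiffAt (hU.mem_nhds hx)).differentiableAt (by simp))
    (((contDiffOn_fderiv_apply hU hb _).contDiffAt (hU.mem_nhds hx)).differentiableAt (by simp))]
  simp only [add_apply, smul_apply, smul_eq_mul]
  ring

/-- Green's formula `∫ a ∇b · ∇φ = -∫ (a Δb + ∇a · ∇b) φ`. -/
lemma IsTestFunction.setIntegral_mul_inner_gradient (hφ : IsTestFunction U φ) (hU : IsOpen U)
    (ha : ContDiffOn ℝ ∞ a U) (hb : ContDiffOn ℝ ∞ b U) :
    IntegrableOn (fun x => a x * inner ℝ (gradient b x) (gradient φ x) +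
      (a x * (Δ b) x + inner ℝ (gradient a x) (gradient b x)) * φ x) U volume ∧
    ∫ x in U, (a x * inner ℝ (gradient b x) (gradient φ x) +
      (a x * (Δ b) x + inner ℝ (gradient a x) (gradient b x)) * φ x) = 0 := by
  have hq : ∀ i : Fin n, ContDiffOn ℝ ∞
      (fun x => a x * fderiv ℝ b x (EuclideanSpace.single i 1)) U :=
    fun i => ha.mul (contDiffOn_fderiv_apply hU hb _)
  have h := fun i => hφ.setIntegral_fderiv_mul hU (hq i) (EuclideanSpace.single i 1)
  have hI := fun i => hφ.integrableOn_fderiv_mul hU (hq i) (EuclideanSpace.single i 1)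
  constructor
  · exact IntegrableOn.congr_fun (integrable_finsetSum Finset.univ fun i _ => hI i)
      (fun x hx => sum_fderiv_mul_eq hU ha hb hx) hU.measurableSet
  · rw [← Finset.sum_eq_zero fun i (_ : i ∈ Finset.univ) => h i,
      ← integral_finsetSum _ fun i _ => hI i]
    exact setIntegral_congr_fun hU.measurableSet
      fun x hx => (sum_fderiv_mul_eq hU ha hb hx).symm

/-- Green's formula `∫ ∇b · ∇φ = -∫ b Δφ`. -/
lemma IsTestFunction.setIntegral_inner_gradient (hφ : IsTestFunction U φ) (hU : IsOpen U)
    (hb : ContDiffOn ℝ ∞ b U) :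
    IntegrableOn (fun x => inner ℝ (gradient b x) (gradient φ x) + b x * (Δ φ) x) U volume ∧
    ∫ x in U, (inner ℝ (gradient b x) (gradient φ x) + b x * (Δ φ) x) = 0 := by
  have h := fun i : Fin n => (hφ.fderiv_apply (EuclideanSpace.single i 1)).setIntegral_fderiv_mul
    hU hb (EuclideanSpace.single i 1)
  have hI := fun i : Fin n => (hφ.fderiv_apply
    (EuclideanSpace.single i 1)).integrableOn_fderiv_mul hU hb (EuclideanSpace.single i 1)
  have hs : ∀ x ∈ U, ∑ i, (fderiv ℝ b x (EuclideanSpace.single i 1) *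
        fderiv ℝ φ x (EuclideanSpace.single i 1) +
      b x * fderiv ℝ (fun x => fderiv ℝ φ x (EuclideanSpace.single i 1)) x
        (EuclideanSpace.single i 1)) =
      inner ℝ (gradient b x) (gradient φ x) + b x * (Δ φ) x := fun x hx => by
    simp only [inner_gradient_eq_sum, laplacian_eq_sum hU hφ.1.contDiffOn hx, Finset.mul_sum,
      ← Finset.sum_add_distrib]
  constructor
  · exact IntegrableOn.congr_fun (integrable_finsetSum Finset.univ fun i _ => hI i) hs
      hU.measurableSet
  · rw [← Finset.sum_eq_zero fun i (_ : i ∈ Finset.univ) => h i,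
      ← integral_finsetSum _ fun i _ => hI i]
    exact setIntegral_congr_fun hU.measurableSet fun x hx => (hs x hx).symm

lemma IsTestFunction.laplacian (hφ : IsTestFunction U φ) : IsTestFunction U (Δ φ) := by
  have : Δ φ = ∑ i, fun x => fderiv ℝ (fun y => fderiv ℝ φ y (EuclideanSpace.single i 1)) x
      (EuclideanSpace.single i 1) := by
    ext x
    rw [laplacian_eq_sum isOpen_univ hφ.1.contDiffOn (mem_univ x), Finset.sum_apply]
  rw [this]
  refine Finset.sum_induction _ (IsTestFunction U) (fun _ _ h1 h2 => h1.add h2)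
    isTestFunction_zero fun i _ => (hφ.fderiv_apply _).fderiv_apply _

end IntegrationByParts

/-! ### Poincaré's inequality. -/

section Poincare

variable {U : Set (EuclideanSpace ℝ (Fin n))}

lemma norm_sq_eq_integral {F : Type*} [NormedAddCommGroup F] [InnerProductSpace ℝ F]
    (f : Lp F 2 (volume : Measure (EuclideanSpace ℝ (Fin n)))) :
    ‖f‖ ^ 2 = ∫ x, ‖f x‖ ^ 2 := by
  rw [← real_inner_self_eq_norm_sq, L2.inner_def]
  simp

lemma norm_toLp_sq {F : Type*} [NormedAddCommGroup F] [InnerProductSpace ℝ F]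
    {f : EuclideanSpace ℝ (Fin n) → F} (hf : MemLp f 2 volume) :
    ‖hf.toLp f‖ ^ 2 = ∫ x, ‖f x‖ ^ 2 := by
  rw [norm_sq_eq_integral]
  refine integral_congr_ae ?_
  filter_upwards [hf.coeFn_toLp] with x hx
  rw [hx]

/-- Poincaré's inequality for test functions supported in a slab. -/
lemma IsTestFunction.poincare {φ : EuclideanSpace ℝ (Fin n) → ℝ} (hφ : IsTestFunction U φ)
    (i : Fin n) {R : ℝ} (hR : ∀ x ∈ U, |x i| ≤ R) :
    ∫ x, φ x ^ 2 ≤ 4 * R ^ 2 * ∫ x, ‖gradient φ x‖ ^ 2 := by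
  have hi : ContDiff ℝ ∞ (fun x : EuclideanSpace ℝ (Fin n) => x i) := by fun_prop
  have hφφ : IsTestFunction U (fun x => φ x * φ x) := by
    refine ⟨hφ.1.mul hφ.1, hφ.2.1.mul_right, (tsupport_mul_subset_left).trans hφ.2.2⟩
  -- The integral of `∂ᵢ(φ² xᵢ) = φ² + 2 xᵢ φ ∂ᵢφ` is zero, so the mass of `φ²` is expressed through
  -- `φ ∂ᵢφ` with a weight bounded by `R`.
  have hψ : IsTestFunction univ (fun x => (φ x * φ x) * x i) :=
    IsTestFunction.mul_contDiffOn ⟨hφφ.1, hφφ.2.1, subset_univ _⟩ isOpen_univ hi.contDiffOn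
  have hder : ∀ x, fderiv ℝ (fun x => (φ x * φ x) * x i) x (EuclideanSpace.single i 1) =
      φ x ^ 2 + 2 * x i * φ x * fderiv ℝ φ x (EuclideanSpace.single i 1) := by
    intro x
    have h1 := hφ.differentiable x
    have h2 : HasFDerivAt (fun x : EuclideanSpace ℝ (Fin n) => x i)
      (EuclideanSpace.proj i : EuclideanSpace ℝ (Fin n) →L[ℝ] ℝ) x :=
      (EuclideanSpace.proj i : EuclideanSpace ℝ (Fin n) →L[ℝ] ℝ).hasFDerivAt
    rw [((h1.hasFDerivAt.fun_mul h1.hasFDerivAt).fun_mul h2).fderiv]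
    simp
    ring
  have h0 := hψ.integral_fderiv_eq_zero (EuclideanSpace.single i 1)
  simp only [hder] at h0
  have hI1 : Integrable (fun x => φ x ^ 2) volume := by
    simpa using hφ.memLp.integrable_sq
  have hI2 : Integrable (fun x => ‖gradient φ x‖ ^ 2) volume :=
    hφ.memLp_gradient.integrable_norm_pow (by norm_num)
  have hI3 : Integrable (fun x => 2 * x i * φ x * fderiv ℝ φ x (EuclideanSpace.single i 1))
      volume := by
    have h := (memLp_one_iff_integrable.1 (hψ.fderiv_apply (EuclideanSpace.single i 1)).memLp)
    simp only [hder] at h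
    exact (h.sub hI1).congr (Eventually.of_forall fun x => by simp)
  rw [integral_add hI1 hI3] at h0
  have key : -∫ x, 2 * x i * φ x * fderiv ℝ φ x (EuclideanSpace.single i 1) ≤
      ∫ x, (φ x ^ 2 / 2 + 2 * R ^ 2 * ‖gradient φ x‖ ^ 2) := by
    rw [← integral_neg]
    refine integral_mono hI3.neg ((hI1.div_const 2).add (hI2.const_mul _)) fun x => ?_
    by_cases hx : x ∈ U
    · have h1 : |fderiv ℝ φ x (EuclideanSpace.single i 1)| ≤ ‖gradient φ x‖ := by
        rw [← inner_gradient_left]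
        refine (abs_real_inner_le_norm _ _).trans ?_
        simp
      have h2 : |x i * fderiv ℝ φ x (EuclideanSpace.single i 1)| ≤ R * ‖gradient φ x‖ := by
        rw [abs_mul]
        exact mul_le_mul (hR x hx) h1 (abs_nonneg _) ((abs_nonneg _).trans (hR x hx))
      have h3 := sq_le_sq' (by linarith [neg_abs_le (x i * fderiv ℝ φ x (EuclideanSpace.single i 1))])
        ((le_abs_self _).trans h2)
      dsimp only
      -- Young's inequality weighted so that half of `∫ φ²` can be absorbed on the left; this yields
      -- the factor 4.
      nlinarith [sq_nonneg (φ x + 2 * (x i * fderiv ℝ φ x (EuclideanSpace.single i 1)))]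
    · simp only [hφ.eq_zero_of_notMem hx]
      simp
      positivity
  rw [integral_add (hI1.div_const 2) (hI2.const_mul _), integral_div, integral_const_mul] at key
  linarith

/-- Poincaré's inequality in `H¹₀(U)`. -/
lemma norm_fst_le (i : Fin n) {R : ℝ} (hR0 : 0 ≤ R) (hR : ∀ x ∈ U, |x i| ≤ R)
    {p : PairL2 n} (hp : p ∈ H10 U) : ‖p.fst‖ ≤ 2 * R * ‖p.snd‖ := by
  refine H10_induction (P := fun p : PairL2 n => ‖p.fst‖ ≤ 2 * R * ‖p.snd‖) ?_ ?_ hp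
  · exact isClosed_le continuous_fst.norm (continuous_const.mul continuous_snd.norm)
  · intro φ hφ
    refine le_of_sq_le_sq ?_ (by positivity)
    have := hφ.poincare i hR
    rw [mul_pow]
    change ‖hφ.memLp.toLp φ‖ ^ 2 ≤ _ * ‖hφ.memLp_gradient.toLp (gradient φ)‖ ^ 2
    rw [norm_toLp_sq, norm_toLp_sq]
    simp only [Real.norm_eq_abs, sq_abs]
    linarith

end Poincare

/-! ### Weak Dirichlet problems and the simply supported problem. -/

section WeakSolutions

variable {U : Set (EuclideanSpace ℝ (Fin n))}

lemma inner_eq_setIntegral {F : Type*} [NormedAddCommGroup F] [InnerProductSpace ℝ F]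
    (hU : MeasurableSet U) (f g : Lp F 2 (volume : Measure (EuclideanSpace ℝ (Fin n))))
    (hg : g =ᵐ[volume.restrict Uᶜ] 0) : inner ℝ f g = ∫ x in U, inner ℝ (f x) (g x) := by
  rw [L2.inner_def, setIntegral_eq_integral_of_ae_compl_eq_zero]
  filter_upwards [(ae_restrict_iff' hU.compl).1 hg] with x hx hxU
  simp [hx hxU]

/-- The gradient on `H¹₀(U)`. -/
def H10.gradL (U : Set (EuclideanSpace ℝ (Fin n))) : H10 U →L[ℝ] VectorL2 n :=
  (WithLp.sndL 2 ℝ (ScalarL2 n) (VectorL2 n)).comp (H10 U).subtypeL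

/-- The bilinear form `(p, q) ↦ ∫ ∇p · ∇q` on `H¹₀(U)`. -/
def dirichletForm (U : Set (EuclideanSpace ℝ (Fin n))) : H10 U →L[ℝ] H10 U →L[ℝ] ℝ :=
  (isBoundedBilinearMap_inner (𝕜 := ℝ) (E := VectorL2 n)).toContinuousLinearMap.bilinearComp
    (H10.gradL U) (H10.gradL U)

@[simp]
lemma dirichletForm_apply (p q : H10 U) :
    dirichletForm U p q = inner ℝ (p : PairL2 n).snd (q : PairL2 n).snd := rfl

lemma isCoercive_dirichletForm (i : Fin n) {R : ℝ} (hR0 : 0 ≤ R) (hR : ∀ x ∈ U, |x i| ≤ R) :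
    IsCoercive (dirichletForm U) := by
  refine ⟨(4 * R ^ 2 + 1)⁻¹, by positivity, fun p => ?_⟩
  rw [dirichletForm_apply, real_inner_self_eq_norm_sq, mul_assoc, inv_mul_le_iff₀ (by positivity),
    ← sq, Submodule.coe_norm, WithLp.prod_norm_sq_eq_of_L2]
  have h := pow_le_pow_left₀ (norm_nonneg _) (norm_fst_le i hR0 hR p.2) 2
  linarith

/-- Existence for the Dirichlet problem of the Laplacian. -/
lemma exists_weak_solution (i : Fin n) {R : ℝ} (hR0 : 0 ≤ R) (hR : ∀ x ∈ U, |x i| ≤ R)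
    (a : ScalarL2 n) :
    ∃ p ∈ H10 U, ∀ t ∈ H10 U, inner ℝ p.snd t.snd = inner ℝ a t.fst := by
  let ℓ : H10 U →L[ℝ] ℝ := (innerSL ℝ a).comp
    ((WithLp.fstL 2 ℝ (ScalarL2 n) (VectorL2 n)).comp (H10 U).subtypeL)
  have hB := isCoercive_dirichletForm i hR0 hR
  let r : H10 U := (InnerProductSpace.toDual ℝ (H10 U)).symm ℓ
  refine ⟨hB.continuousLinearEquivOfBilin.symm r, Subtype.property _, fun t ht => ?_⟩
  have h1 := hB.continuousLinearEquivOfBilin_apply (hB.continuousLinearEquivOfBilin.symm r) ⟨t, ht⟩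
  rw [ContinuousLinearEquiv.apply_symm_apply, dirichletForm_apply] at h1
  rw [← h1, InnerProductSpace.toDual_symm_apply]
  rfl

/-- The energy estimate for the Dirichlet problem of the Laplacian. -/
lemma norm_fst_le_of_weak (i : Fin n) {R : ℝ} (hR0 : 0 ≤ R) (hR : ∀ x ∈ U, |x i| ≤ R)
    {p : PairL2 n} (hp : p ∈ H10 U) (a : ScalarL2 n) (b : VectorL2 n)
    (h : ∀ t ∈ H10 U, inner ℝ p.snd t.snd = inner ℝ a t.fst + inner ℝ b t.snd) :
    ‖p.fst‖ ≤ 2 * R * (2 * R * ‖a‖ + ‖b‖) := by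
  have h1 := norm_fst_le i hR0 hR hp
  have h2 := h p hp
  rw [real_inner_self_eq_norm_sq] at h2
  have h3 := real_inner_le_norm a p.fst
  have h4 := real_inner_le_norm b p.snd
  -- Testing with `p` itself and using Poincaré gives `‖∇p‖² ≤ (2R‖a‖ + ‖b‖)‖∇p‖`; divide by `‖∇p‖`.
  have h5 : ‖p.snd‖ ≤ 2 * R * ‖a‖ + ‖b‖ := by
    by_contra! hlt
    have h6 : ‖a‖ * ‖p.fst‖ ≤ ‖a‖ * (2 * R * ‖p.snd‖) :=
      mul_le_mul_of_nonneg_left h1 (norm_nonneg _)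
    have h7 : 0 < ‖p.snd‖ := lt_of_le_of_lt (by positivity) hlt
    nlinarith
  exact h1.trans (mul_le_mul_of_nonneg_left h5 (by positivity))

/-- Replaces integrals over `U` by L² inner products over the whole space, which is legitimate
because elements of H¹₀(U) and their gradients vanish off `U`. Only the values of `h` on `U` matter,
so `a` may be one L² class serving all `U`. -/
lemma laplacianEq_iff (hU : MeasurableSet U) {p : PairL2 n}
    {G : EuclideanSpace ℝ (Fin n) → EuclideanSpace ℝ (Fin n)} (hG : p.snd =ᵐ[volume] G)
    {h : EuclideanSpace ℝ (Fin n) → ℝ} {a : ScalarL2 n} (ha : a =ᵐ[volume.restrict U] h) :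
    LaplacianEq U G h ↔ ∀ t ∈ H10 U, -inner ℝ p.snd t.snd = inner ℝ a t.fst := by
  have key : ∀ (t : PairL2 n), t ∈ H10 U → ∀ (φ : EuclideanSpace ℝ (Fin n) → ℝ)
      (Gφ : EuclideanSpace ℝ (Fin n) → EuclideanSpace ℝ (Fin n)), t.fst =ᵐ[volume] φ →
      t.snd =ᵐ[volume] Gφ →
      inner ℝ p.snd t.snd = ∫ x in U, inner ℝ (G x) (Gφ x) ∧
        inner ℝ a t.fst = ∫ x in U, h x * φ x := by
    intro t ht φ Gφ h1 h2
    have h0 := ae_eq_zero_of_mem_H10 hU ht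
    rw [inner_eq_setIntegral hU _ _ h0.1, inner_eq_setIntegral hU _ _ h0.2]
    constructor
    · refine integral_congr_ae ?_
      filter_upwards [ae_restrict_of_ae hG, ae_restrict_of_ae h2] with x hx1 hx2
      rw [hx1, hx2]
    · refine integral_congr_ae ?_
      filter_upwards [ha, ae_restrict_of_ae h1] with x hx1 hx2
      rw [hx1, hx2, real_inner_eq_re_inner, mul_comm]
      rfl
  constructor
  · intro H t ht
    obtain ⟨k1, k2⟩ := key t ht _ _ EventuallyEq.rfl EventuallyEq.rfl
    rw [k1, k2]
    exact H _ _ (inH10_of_mem ht)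
  · intro H φ Gφ hφ
    obtain ⟨t, ht, h1, h2⟩ := inH10_iff.1 hφ
    obtain ⟨k1, k2⟩ := key t ht _ _ h1 h2
    rw [← k1, ← k2]
    exact H t ht

/-- The fourth-order problem becomes two successive Dirichlet problems in the Hilbert space, `q`
standing for `Δu`. -/
lemma isSolution_iff (hU : MeasurableSet U) {f u : EuclideanSpace ℝ (Fin n) → ℝ}
    {a : ScalarL2 n} (ha : a =ᵐ[volume.restrict U] f) :
    IsSolution U f u ↔ ∃ p ∈ H10 U, ∃ q ∈ H10 U, p.fst =ᵐ[volume] u ∧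
      (∀ t ∈ H10 U, -inner ℝ p.snd t.snd = inner ℝ q.fst t.fst) ∧
      (∀ t ∈ H10 U, -inner ℝ q.snd t.snd = inner ℝ a t.fst) := by
  constructor
  · rintro ⟨Gu, v, Gv, hu, hv, h1, h2⟩
    obtain ⟨p, hp, hp1, hp2⟩ := inH10_iff.1 hu
    obtain ⟨q, hq, hq1, hq2⟩ := inH10_iff.1 hv
    exact ⟨p, hp, q, hq, hp1, (laplacianEq_iff hU hp2 (ae_restrict_of_ae hq1)).1 h1,
      (laplacianEq_iff hU hq2 ha).1 h2⟩
  · rintro ⟨p, hp, q, hq, hp1, h1, h2⟩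
    exact ⟨p.snd, q.fst, q.snd, inH10_iff.2 ⟨p, hp, hp1, EventuallyEq.rfl⟩, inH10_of_mem hq,
      (laplacianEq_iff hU EventuallyEq.rfl EventuallyEq.rfl).2 h1,
      (laplacianEq_iff hU EventuallyEq.rfl ha).2 h2⟩

/-- Existence and uniqueness for the simply supported biharmonic problem. -/
lemma exists_unique_isSolution (i : Fin n) {R : ℝ} (hR0 : 0 ≤ R) (hR : ∀ x ∈ U, |x i| ≤ R)
    (hU : MeasurableSet U) {f : EuclideanSpace ℝ (Fin n) → ℝ}
    {a : ScalarL2 n} (ha : a =ᵐ[volume.restrict U] f) :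
    ∃ u, IsSolution U f u ∧ ∀ u', IsSolution U f u' → u' =ᵐ[volume] u := by
  have unique : ∀ p ∈ H10 U, ∀ p' ∈ H10 U,
      (∀ t ∈ H10 U, inner ℝ p.snd t.snd = inner ℝ p'.snd t.snd) → p.fst = p'.fst := by
    intro p hp p' hp' h
    have := norm_fst_le_of_weak i hR0 hR (Submodule.sub_mem _ hp hp') 0 0 (fun t ht => by
      rw [WithLp.sub_snd, inner_sub_left, h t ht]; simp)
    simp only [norm_zero, mul_zero, add_zero] at this
    have h0 := norm_le_zero_iff.1 this
    rwa [WithLp.sub_fst, sub_eq_zero] at h0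
  -- The signs come from the convention: the form represents `-Δ`, while `q` and `p` must satisfy
  -- `Δq = f` and `Δp = q`.
  obtain ⟨q, hq, hq1⟩ := exists_weak_solution i hR0 hR (-a)
  obtain ⟨p, hp, hp1⟩ := exists_weak_solution i hR0 hR (-q.fst)
  refine ⟨p.fst, (isSolution_iff hU ha).2 ⟨p, hp, q, hq, EventuallyEq.rfl, ?_, ?_⟩, ?_⟩
  · intro t ht
    rw [hp1 t ht, inner_neg_left, neg_neg]
  · intro t ht
    rw [hq1 t ht, inner_neg_left, neg_neg]
  · intro u' hu'
    obtain ⟨p', hp', q', hq', h1, h2, h3⟩ := (isSolution_iff hU ha).1 hu'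
    have e1 : q'.fst = q.fst := unique q' hq' q hq fun t ht => by
      rw [hq1 t ht, inner_neg_left, ← h3 t ht, neg_neg]
    have e2 : p'.fst = p.fst := unique p' hp' p hp fun t ht => by
      rw [hp1 t ht, inner_neg_left, ← e1, ← h2 t ht, neg_neg]
    rw [← e2]
    exact h1.symm

end WeakSolutions

/-! ### Membership in H¹₀ by truncation near zero. -/

section Truncation

lemma tendsto_eLpNorm_two_of_dominated {α F : Type*} [MeasurableSpace α] [NormedAddCommGroup F]
    {μ : Measure α} {f : ℕ → α → F} {s : Set α} (hs : MeasurableSet s) (hμs : μ s ≠ ⊤) {C : ℝ}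
    (hf : ∀ k, AEStronglyMeasurable (f k) μ) (hC : ∀ k, ∀ x ∈ s, ‖f k x‖ ≤ C)
    (h0 : ∀ k, ∀ x ∉ s, f k x = 0) (hlim : ∀ x ∈ s, Tendsto (fun k => f k x) atTop (𝓝 0)) :
    Tendsto (fun k => eLpNorm (f k) 2 μ) atTop (𝓝 0) := by
  have h : Tendsto (fun k => ∫⁻ x, ‖f k x‖ₑ ^ (2 : ℝ) ∂μ) atTop (𝓝 (∫⁻ _, 0 ∂μ)) := by
    refine tendsto_lintegral_of_dominated_convergence'
      (s.indicator fun _ => ENNReal.ofReal C ^ (2 : ℝ)) (fun k => (hf k).enorm.pow_const _) ?_ ?_ ?_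
    · refine fun k => Eventually.of_forall fun x => ?_
      by_cases hx : x ∈ s
      · rw [indicator_of_mem hx]
        refine ENNReal.rpow_le_rpow ?_ (by norm_num)
        rw [← ofReal_norm]
        exact ENNReal.ofReal_le_ofReal (hC k x hx)
      · simp [h0 k x hx]
    · rw [lintegral_indicator_const hs]
      exact ENNReal.mul_ne_top (by simp) hμs
    · refine Eventually.of_forall fun x => ?_
      by_cases hx : x ∈ s
      · have h1 := (hlim x hx).enorm
        rw [enorm_zero] at h1
        have h2 := h1.ennrpow_const 2
        simpa using h2
      · simp [h0 _ x hx]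
  rw [lintegral_zero] at h
  have h2 := h.ennrpow_const (1 / 2)
  rw [ENNReal.zero_rpow_of_pos (by norm_num)] at h2
  refine h2.congr fun k => ?_
  rw [eLpNorm_eq_lintegral_rpow_enorm_toReal (by norm_num) (by norm_num)]
  norm_num

lemma memLp_two_of_bound {α F : Type*} [MeasurableSpace α] [NormedAddCommGroup F]
    {μ : Measure α} {f : α → F} {s : Set α} (hs : MeasurableSet s) (hμs : μ s ≠ ⊤) {C : ℝ}
    (hf : AEStronglyMeasurable f μ) (hC : ∀ x ∈ s, ‖f x‖ ≤ C) (h0 : ∀ x ∉ s, f x = 0) :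
    MemLp f 2 μ := by
  refine (memLp_indicator_const 2 hs C (Or.inr hμs)).of_le hf (Eventually.of_forall fun x => ?_)
  by_cases hx : x ∈ s
  · rw [indicator_of_mem hx]
    exact (hC x hx).trans (le_abs_self C)
  · simp [h0 x hx]

/-- A smooth truncation of the identity near zero. -/
lemma exists_truncation : ∃ η : ℝ → ℝ, ContDiff ℝ ∞ η ∧ (∀ t, |t| ≤ 1 → η t = 0) ∧
    (∀ t, 2 ≤ |t| → η t = t) ∧ (∃ C, ∀ t, |η t - t| ≤ C) ∧ ∃ C, ∀ t, |deriv η t| ≤ C := by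
  -- The truncation is `t(1 - b(t))`, with `b = 1` on `[-1, 1]` and `b = 0` beyond distance 2; it
  -- differs from the identity by a compactly supported function.
  let b : ContDiffBump (0 : ℝ) := ⟨1, 2, one_pos, one_lt_two⟩
  have hb : ContDiff ℝ ∞ (fun t => t * b t) := contDiff_id.mul b.contDiff
  have hc : HasCompactSupport (fun t => t * b t) := b.hasCompactSupport.mul_left
  obtain ⟨C1, hC1⟩ := hc.exists_bound_of_continuous hb.continuous
  obtain ⟨C2, hC2⟩ := hc.deriv.exists_bound_of_continuous (hb.continuous_deriv (by simp))
  refine ⟨fun t => t - t * b t, contDiff_id.sub hb, fun t ht => ?_, fun t ht => ?_,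
    ⟨C1, fun t => ?_⟩, ⟨1 + C2, fun t => ?_⟩⟩
  · dsimp only
    rw [b.one_of_mem_closedBall (by simpa using ht)]
    ring
  · dsimp only
    rw [b.zero_of_le_dist (by simpa using ht)]
    ring
  · simpa using hC1 t
  · rw [deriv_fun_sub differentiableAt_fun_id (hb.differentiable (by simp) t)]
    refine (abs_sub _ _).trans ?_
    simpa using hC2 t

lemma gradient_comp_real {η : ℝ → ℝ} {u : EuclideanSpace ℝ (Fin n) → ℝ}
    {x : EuclideanSpace ℝ (Fin n)} (hη : DifferentiableAt ℝ η (u x))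
    (hu : DifferentiableAt ℝ u x) :
    gradient (fun y => η (u y)) x = deriv η (u x) • gradient u x := by
  have h : HasFDerivAt (fun y => η (u y)) (deriv η (u x) • fderiv ℝ u x) x :=
    hη.hasDerivAt.comp_hasFDerivAt x hu.hasFDerivAt
  rw [gradient, h.fderiv, map_smul]
  rfl

/-- A bounded smooth function with bounded gradient that vanishes at the boundary belongs to
`H¹₀`. -/
lemma exists_mem_H10 {U : Set (EuclideanSpace ℝ (Fin n))} (hU : IsOpen U)
    (hUfin : volume U ≠ ⊤) {u : EuclideanSpace ℝ (Fin n) → ℝ} (hu : ContDiffOn ℝ ∞ u U)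
    {M : ℝ} (hM : ∀ x ∈ U, |u x| ≤ M) (hM' : ∀ x ∈ U, ‖gradient u x‖ ≤ M)
    (hK : ∀ δ > 0, IsCompact {x | x ∈ U ∧ δ ≤ |u x|}) :
    ∃ p ∈ H10 U, p.fst =ᵐ[volume] U.indicator u := by
  obtain ⟨η, hη, hη0, hη2, ⟨C, hC⟩, ⟨C', hC'⟩⟩ := exists_truncation
  have hdη : ∀ t, DifferentiableAt ℝ η t := fun t => hη.differentiable (by simp) t
  have hdu : ∀ x ∈ U, DifferentiableAt ℝ u x := fun x hx =>
    (hu.contDiffAt (hU.mem_nhds hx)).differentiableAt (by simp)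
  have hC'0 : 0 ≤ C' := (abs_nonneg _).trans (hC' 0)
  let c : ℕ → ℝ := fun k => k + 1
  have hc : ∀ k, 0 < c k := fun k => by positivity
  have hclim : Tendsto c atTop atTop := tendsto_natCast_atTop_atTop.atTop_add tendsto_const_nhds
  -- Rescaling `η` cuts `u` off where `|u| ≤ 1/c`. The support then lies in a compact superlevel
  -- set, the error is at most `C/c`, and the gradients stay bounded because the factors `c` cancel.
  let φ : ℕ → EuclideanSpace ℝ (Fin n) → ℝ := fun k =>
    U.indicator fun x => (c k)⁻¹ * η (c k * u x)
  have hφU : ∀ k, ∀ x ∈ U, φ k x = (c k)⁻¹ * η (c k * u x) := fun k x hx => indicator_of_mem hx _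
  have hφ0 : ∀ k x, x ∉ {x | x ∈ U ∧ (c k)⁻¹ ≤ |u x|} → φ k x = 0 := by
    intro k x hx
    by_cases hxU : x ∈ U
    · rw [hφU k x hxU, hη0, mul_zero]
      have : |u x| < (c k)⁻¹ := by
        by_contra! h
        exact hx ⟨hxU, h⟩
      rw [abs_mul, abs_of_pos (hc k)]
      calc c k * |u x| ≤ c k * (c k)⁻¹ := by gcongr
        _ = 1 := mul_inv_cancel₀ (hc k).ne'
    · exact indicator_of_notMem hxU _
  have hφts : ∀ k, tsupport (φ k) ⊆ {x | x ∈ U ∧ (c k)⁻¹ ≤ |u x|} := fun k =>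
    closure_minimal (fun x hx => by_contra fun h => hx (hφ0 k x h))
      (hK _ (inv_pos.2 (hc k))).isClosed
  have hφ : ∀ k, IsTestFunction U (φ k) := by
    intro k
    refine ⟨contDiff_iff_contDiffAt.2 fun x => ?_,
      (hK _ (inv_pos.2 (hc k))).of_isClosed_subset (isClosed_tsupport _) (hφts k),
      (hφts k).trans fun x hx => hx.1⟩
    by_cases hxU : x ∈ U
    · have h1 : ContDiffAt ℝ ∞ (fun x => (c k)⁻¹ * η (c k * u x)) x :=
        contDiffAt_const.mul (hη.contDiffAt.comp x
          (contDiffAt_const.mul (hu.contDiffAt (hU.mem_nhds hxU))))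
      refine h1.congr_of_eventuallyEq ?_
      filter_upwards [hU.mem_nhds hxU] with y hy using hφU k y hy
    · have h1 : {x | x ∈ U ∧ (c k)⁻¹ ≤ |u x|}ᶜ ∈ 𝓝 x :=
        (hK _ (inv_pos.2 (hc k))).isClosed.isOpen_compl.mem_nhds fun h => hxU h.1
      refine (contDiffAt_const (c := (0 : ℝ))).congr_of_eventuallyEq ?_
      filter_upwards [h1] with y hy using hφ0 k y hy
  have hgφ : ∀ k, ∀ x ∈ U, gradient (φ k) x = deriv η (c k * u x) • gradient u x := by
    intro k x hx
    have h1 : φ k =ᶠ[𝓝 x] fun y => (fun t => (c k)⁻¹ * η (c k * t)) (u y) := by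
      filter_upwards [hU.mem_nhds hx] with y hy using hφU k y hy
    have h2 : HasDerivAt (fun t => (c k)⁻¹ * η (c k * t)) (deriv η (c k * u x)) (u x) := by
      have h3 : HasDerivAt (fun t : ℝ => c k * t) (c k) (u x) := by
        simpa using (hasDerivAt_id (u x)).const_mul (c k)
      have h4 := ((hdη (c k * u x)).hasDerivAt.comp (u x) h3).const_mul (c k)⁻¹
      have h5 : (c k)⁻¹ * (deriv η (c k * u x) * c k) = deriv η (c k * u x) := by
        field_simp [(hc k).ne']
      rw [h5] at h4
      exact h4
    rw [h1.gradient_eq, gradient_comp_real h2.differentiableAt (hdu x hx), h2.deriv]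
  -- Where `u = 0` all truncations have zero gradient, so the pointwise limit is `∇u` cut off to `{u
  -- ≠ 0}`. Using this limit directly avoids showing that `∇u = 0` almost everywhere on `{u = 0}`.
  let G : EuclideanSpace ℝ (Fin n) → EuclideanSpace ℝ (Fin n) := fun x =>
    {x | x ∈ U ∧ u x ≠ 0}.indicator (gradient u) x
  have hlimG : ∀ x, ∀ᶠ k in atTop, gradient (φ k) x = G x := by
    intro x
    by_cases hx : x ∈ U
    · by_cases hux : u x = 0
      · refine Eventually.of_forall fun k => ?_
        have h0 : deriv η 0 = 0 := by
          have : η =ᶠ[𝓝 0] fun _ => 0 := by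
            filter_upwards [Metric.ball_mem_nhds (0 : ℝ) one_pos] with t ht
            exact hη0 t (by simpa using (mem_ball_zero_iff.1 ht).le)
          rw [this.deriv_eq, deriv_const]
        rw [hgφ k x hx, hux, mul_zero, h0, zero_smul]
        exact (indicator_of_notMem (fun h => h.2 hux) _).symm
      · have h1 : ∀ᶠ k in atTop, 2 < c k * |u x| :=
          (hclim.atTop_mul_const (abs_pos.2 hux)).eventually_gt_atTop 2
        filter_upwards [h1] with k hk
        rw [hgφ k x hx]
        have h2 : deriv η (c k * u x) = 1 := by
          have : η =ᶠ[𝓝 (c k * u x)] fun t => t := by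
            have h3 : 2 < |c k * u x| := by rwa [abs_mul, abs_of_pos (hc k)]
            filter_upwards [(isOpen_lt continuous_const continuous_abs).mem_nhds h3] with t ht
            exact hη2 t (le_of_lt ht)
          rw [this.deriv_eq]
          exact deriv_id _
        rw [h2, one_smul]
        exact (indicator_of_mem (show x ∈ {x | x ∈ U ∧ u x ≠ 0} from ⟨hx, hux⟩) _).symm
    · refine Eventually.of_forall fun k => ?_
      rw [(hφ k).gradient_eq_zero_of_notMem hx]
      exact (indicator_of_notMem (fun h => hx h.1) _).symm
  have hGbd : ∀ x ∈ U, ‖G x‖ ≤ M := fun x hx =>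
    (norm_indicator_le_norm_self _ _).trans (hM' x hx)
  have hG0 : ∀ x ∉ U, G x = 0 := fun x hx => indicator_of_notMem (fun h => hx h.1) _
  have hGm : AEStronglyMeasurable G volume := by
    refine aestronglyMeasurable_of_tendsto_ae atTop
      (f := fun k => gradient (φ k)) (fun k => (hφ k).continuous_gradient.aestronglyMeasurable)
      (Eventually.of_forall fun x => ?_)
    exact tendsto_const_nhds.congr' ((hlimG x).mono fun k hk => hk.symm)
  have hum : AEStronglyMeasurable (U.indicator u) volume :=
    (aestronglyMeasurable_indicator_iff hU.measurableSet).2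
      (hu.continuousOn.aestronglyMeasurable hU.measurableSet)
  have hmem : InH10 U (U.indicator u) G := by
    refine ⟨memLp_two_of_bound (C := M) hU.measurableSet hUfin hum ?_ ?_, memLp_two_of_bound hU.measurableSet hUfin hGm hGbd hG0, φ, hφ, ?_, ?_⟩
    · intro x hx
      rw [indicator_of_mem hx]
      exact hM x hx
    · intro x hx
      exact indicator_of_notMem hx _
    · have hdiff : ∀ k, ∀ x ∈ U, |φ k x - U.indicator u x| ≤ (c k)⁻¹ * C := by
        intro k x hx
        rw [hφU k x hx, indicator_of_mem hx]
        have : (c k)⁻¹ * η (c k * u x) - u x = (c k)⁻¹ * (η (c k * u x) - c k * u x) := by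
          field_simp [(hc k).ne']
        rw [this, abs_mul, abs_of_pos (inv_pos.2 (hc k))]
        exact mul_le_mul_of_nonneg_left (hC _) (inv_pos.2 (hc k)).le
      have hC0 : 0 ≤ C := (abs_nonneg _).trans (hC 0)
      refine tendsto_eLpNorm_two_of_dominated hU.measurableSet hUfin (C := C)
        (fun k => ((hφ k).1.continuous.aestronglyMeasurable).sub hum) ?_ ?_ ?_
      · intro k x hx
        refine (hdiff k x hx).trans (mul_le_of_le_one_left hC0 ?_)
        exact inv_le_one_of_one_le₀ (by simp [c])
      · intro k x hx
        rw [(hφ k).eq_zero_of_notMem hx, indicator_of_notMem hx, sub_zero]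
      · intro x hx
        refine squeeze_zero_norm (fun k => hdiff k x hx) ?_
        simpa using hclim.inv_tendsto_atTop.mul_const C
    · refine tendsto_eLpNorm_two_of_dominated hU.measurableSet hUfin (C := C' * M + M)
        (fun k => ((hφ k).continuous_gradient.aestronglyMeasurable).sub hGm) ?_ ?_ ?_
      · intro k x hx
        refine (norm_sub_le _ _).trans (add_le_add ?_ (hGbd x hx))
        rw [hgφ k x hx, norm_smul]
        exact mul_le_mul (hC' _) (hM' x hx) (norm_nonneg _) hC'0
      · intro k x hx
        rw [(hφ k).gradient_eq_zero_of_notMem hx, hG0 x hx, sub_zero]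
      · intro x hx
        refine tendsto_const_nhds.congr' ((hlimG x).mono fun k hk => ?_)
        simp [hk]
  obtain ⟨p, hp, h1, -⟩ := inH10_iff.1 hmem
  exact ⟨p, hp, h1⟩

end Truncation

/-! ### Correctors and the homogenization estimate. -/

/-- A smooth function on `Ω` with bounded value, gradient and Laplacian that vanishes at the
boundary. -/
structure IsProfile (Ω : Set (EuclideanSpace ℝ (Fin n))) (h : EuclideanSpace ℝ (Fin n) → ℝ)
    (M : ℝ) : Prop where
  contDiffOn : ContDiffOn ℝ ∞ h Ω
  bound : ∀ x ∈ Ω, |h x| ≤ M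
  bound_gradient : ∀ x ∈ Ω, ‖gradient h x‖ ≤ M
  bound_laplacian : ∀ x ∈ Ω, |(Δ h) x| ≤ M
  isCompact : ∀ δ > 0, IsCompact {x | x ∈ Ω ∧ δ ≤ |h x|}

/-- A function `θ` on the perforated domain `U ⊆ Ω` with `Δθ = -1` in `U` that vanishes on the
holes. -/
structure IsCorrector (Ω U : Set (EuclideanSpace ℝ (Fin n))) (θ : EuclideanSpace ℝ (Fin n) → ℝ) :
    Prop where
  isOpen : IsOpen U
  subset : U ⊆ Ω
  contDiffOn : ContDiffOn ℝ ∞ θ U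
  bounded : ∃ M, ∀ x ∈ U, |θ x| ≤ M ∧ ‖gradient θ x‖ ≤ M
  laplacian : ∀ x ∈ U, (Δ θ) x = -1
  isCompact : ∀ K ⊆ Ω, IsCompact K → ∀ δ > 0, IsCompact {x | x ∈ U ∧ x ∈ K ∧ δ ≤ |θ x|}
  memLp : MemLp (Ω.indicator fun x => θ x - 1) 2 volume
  le_of_notMem : ∀ᵐ x ∂volume, x ∈ Ω → x ∉ U → 1 ≤ |θ x - 1|

variable {Ω U : Set (EuclideanSpace ℝ (Fin n))} {θ h : EuclideanSpace ℝ (Fin n) → ℝ} {M : ℝ}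

lemma gradient_mul {a b : EuclideanSpace ℝ (Fin n) → ℝ} {x : EuclideanSpace ℝ (Fin n)}
    (ha : DifferentiableAt ℝ a x) (hb : DifferentiableAt ℝ b x) :
    gradient (fun y => a y * b y) x = a x • gradient b x + b x • gradient a x := by
  rw [gradient, fderiv_fun_mul ha hb, map_add, map_smul, map_smul]
  rfl

lemma gradient_const_sub (c : ℝ) (a : EuclideanSpace ℝ (Fin n) → ℝ)
    (x : EuclideanSpace ℝ (Fin n)) :
    gradient (fun y => c - a y) x = -gradient a x := by
  rw [gradient, fderiv_const_sub, map_neg]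
  rfl

/-- The two factors vanish on complementary parts of the boundary of `U`: `θ` at the holes, `h` at
`∂Ω`. A bounded product that is large forces both factors to be large, so its superlevel sets are
compact in `U`. -/
lemma IsCorrector.exists_mem_H10_mul (hθ : IsCorrector Ω U θ) (hh : IsProfile Ω h M)
    (hΩfin : volume Ω ≠ ⊤) :
    ∃ p ∈ H10 U, p.fst =ᵐ[volume] U.indicator fun x => θ x * h x := by
  obtain ⟨A, hA⟩ := hθ.bounded
  have hUfin : volume U ≠ ⊤ := ne_top_of_le_ne_top hΩfin (measure_mono hθ.subset)
  have hhU := hh.contDiffOn.mono hθ.subset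
  by_cases hne : U = ∅
  · refine ⟨0, zero_mem _, ?_⟩
    subst hne
    rw [indicator_empty]
    exact Lp.coeFn_zero ℝ 2 (volume : Measure (EuclideanSpace ℝ (Fin n)))
  obtain ⟨x₀, hx₀⟩ := nonempty_iff_ne_empty.2 hne
  have hA0 : 0 ≤ A := (abs_nonneg _).trans (hA x₀ hx₀).1
  have hM0 : 0 ≤ M := (abs_nonneg _).trans (hh.bound x₀ (hθ.subset hx₀))
  have hθh : ContDiffOn ℝ ∞ (fun x => θ x * h x) U := hθ.contDiffOn.mul hhU
  refine exists_mem_H10 hθ.isOpen hUfin hθh (M := 2 * A * M + 0) ?_ ?_ ?_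
  · intro x hx
    rw [abs_mul]
    have := mul_le_mul (hA x hx).1 (hh.bound x (hθ.subset hx)) (abs_nonneg _) hA0
    nlinarith [mul_nonneg hA0 hM0]
  · intro x hx
    have hx' := hθ.isOpen.mem_nhds hx
    rw [gradient_mul ((hθ.contDiffOn.contDiffAt hx').differentiableAt (by simp))
      ((hhU.contDiffAt hx').differentiableAt (by simp))]
    refine (norm_add_le _ _).trans ?_
    rw [norm_smul, norm_smul]
    have h1 := mul_le_mul (hA x hx).1 (hh.bound_gradient x (hθ.subset hx)) (norm_nonneg _) hA0
    have h2 := mul_le_mul (hh.bound x (hθ.subset hx)) (hA x hx).2 (norm_nonneg _) hM0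
    simp only [Real.norm_eq_abs]
    linarith
  · intro δ hδ
    have hK := hθ.isCompact _ (fun x hx => hx.1)
      (hh.isCompact (δ / (A + 1)) (by positivity)) (δ / (M + 1)) (by positivity)
    have hcl := (hθh.continuousOn.mono (fun x hx => hx.1)).preimage_isClosed_of_isClosed
      hK.isClosed (isClosed_le continuous_const continuous_abs : IsClosed {t : ℝ | δ ≤ |t|})
    convert hK.of_isClosed_subset hcl inter_subset_left using 1
    ext x
    constructor
    · rintro ⟨hxU, hx⟩
      refine ⟨⟨hxU, ⟨hθ.subset hxU, ?_⟩, ?_⟩, hx⟩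
      · rw [div_le_iff₀ (by positivity)]
        rw [abs_mul] at hx
        nlinarith [(hA x hxU).1, abs_nonneg (h x)]
      · rw [div_le_iff₀ (by positivity)]
        rw [abs_mul] at hx
        nlinarith [hh.bound x (hθ.subset hxU), abs_nonneg (θ x)]
    · exact fun hx => ⟨hx.1.1, hx.2⟩

lemma inner_eq_integral_of_ae_eq {F : Type*} [NormedAddCommGroup F] [InnerProductSpace ℝ F]
    {p q : Lp F 2 (volume : Measure (EuclideanSpace ℝ (Fin n)))}
    {f g : EuclideanSpace ℝ (Fin n) → F} (hf : p =ᵐ[volume] f) (hg : q =ᵐ[volume] g) :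
    inner ℝ p q = ∫ x, inner ℝ (f x) (g x) := by
  rw [L2.inner_def]
  refine integral_congr_ae ?_
  filter_upwards [hf, hg] with x h1 h2
  rw [h1, h2]

lemma integrable_inner_of_memLp {F : Type*} [NormedAddCommGroup F] [InnerProductSpace ℝ F]
    {f g : EuclideanSpace ℝ (Fin n) → F} (hf : MemLp f 2 volume) (hg : MemLp g 2 volume) :
    Integrable (fun x => inner ℝ (f x) (g x)) volume := by
  refine (L2.integrable_inner (𝕜 := ℝ) (hf.toLp f) (hg.toLp g)).congr ?_
  filter_upwards [hf.coeFn_toLp, hg.coeFn_toLp] with x h1 h2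
  rw [h1, h2]

/-- The gradient of an element of `H¹₀(U)` is its distributional gradient. -/
lemma inner_snd_gradient {V : Set (EuclideanSpace ℝ (Fin n))} {φ : EuclideanSpace ℝ (Fin n) → ℝ}
    (hφ : IsTestFunction V φ) {p : PairL2 n} (hp : p ∈ H10 U) :
    inner ℝ p.snd (hφ.memLp_gradient.toLp (gradient φ)) =
      -inner ℝ p.fst (hφ.laplacian.memLp.toLp (Δ φ)) := by
  refine H10_induction (P := fun p : PairL2 n =>
    inner ℝ p.snd (hφ.memLp_gradient.toLp (gradient φ)) =
      -inner ℝ p.fst (hφ.laplacian.memLp.toLp (Δ φ))) ?_ ?_ hp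
  · exact isClosed_eq (continuous_snd.inner continuous_const)
      (continuous_fst.inner continuous_const).neg
  · intro ψ hψ
    rw [inner_eq_integral_of_ae_eq (mkPair_snd_ae _ _) (MemLp.coeFn_toLp _),
      inner_eq_integral_of_ae_eq (mkPair_fst_ae _ _) (MemLp.coeFn_toLp _)]
    have hφ' : IsTestFunction univ φ := ⟨hφ.1, hφ.2.1, subset_univ _⟩
    have h1 := (hφ'.setIntegral_inner_gradient isOpen_univ hψ.1.contDiffOn).2
    rw [setIntegral_univ, integral_add] at h1
    · simp only [RCLike.inner_apply, conj_trivial, mul_comm ((Δ φ) _)]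
      linarith
    · exact integrable_inner_of_memLp hψ.memLp_gradient hφ.memLp_gradient
    · exact MemLp.integrable_mul (p := 2) (q := 2) hψ.memLp hφ.laplacian.memLp

/-- The product of a corrector and a profile nearly solves the limit problem. -/
lemma IsCorrector.classical_identity (hθ : IsCorrector Ω U θ) (hh : IsProfile Ω h M)
    {φ : EuclideanSpace ℝ (Fin n) → ℝ} (hφ : IsTestFunction U φ) :
    ∫ x in U, (θ x * h x * (Δ φ) x + (-(Δ h) x + h x) * φ x + (θ x - 1) * (Δ h) x * φ x +
      2 * (θ x - 1) * inner ℝ (gradient h x) (gradient φ x)) = 0 := by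
  have hU := hθ.isOpen
  have hhU := hh.contDiffOn.mono hθ.subset
  -- The weight `2 - θ` makes the terms `∇θ · ∇h` cancel: subtracting from the Green formula for
  -- `θh` the one for `θ` with weight `h` and the one for `h` with weight `2 - θ` leaves `θ`
  -- undifferentiated.
  have hc : ContDiffOn ℝ ∞ (fun x => 2 - θ x) U := contDiffOn_const.sub hθ.contDiffOn
  have h1 := hφ.setIntegral_inner_gradient hU (hθ.contDiffOn.mul hhU)
  have h2 := hφ.setIntegral_mul_inner_gradient hU hhU hθ.contDiffOn
  have h3 := hφ.setIntegral_mul_inner_gradient hU hc hhU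
  have h4 := integral_sub (h1.1.sub h2.1) h3.1
  have h5 := integral_sub h1.1 h2.1
  rw [h1.2, h2.2, sub_zero] at h5
  simp only [Pi.sub_apply] at h4
  rw [h5, h3.2, sub_zero] at h4
  rw [← h4]
  refine setIntegral_congr_fun hU.measurableSet fun x hx => ?_
  have hx' := hU.mem_nhds hx
  have e1 := gradient_mul ((hθ.contDiffOn.contDiffAt hx').differentiableAt (by simp))
      ((hhU.contDiffAt hx').differentiableAt (by simp))
  simp only [e1, gradient_const_sub, hθ.laplacian x hx, inner_add_left, inner_neg_left,
    real_inner_smul_left, real_inner_comm (gradient h x) (gradient θ x)]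
  ring

/-- Solutions on the perforated domain are close to solutions of the limit problem with the
zeroth-order term. -/
lemma IsCorrector.norm_sub_le (hθ : IsCorrector Ω U θ) (hh : IsProfile Ω h M)
    (hΩfin : volume Ω ≠ ⊤) (hM0 : 0 ≤ M)
    (i : Fin n) {R : ℝ} (hR0 : 0 ≤ R) (hR : ∀ x ∈ Ω, |x i| ≤ R)
    {p : PairL2 n} (hp : p ∈ H10 U) {a g H : ScalarL2 n}
    (hpa : ∀ t ∈ H10 U, inner ℝ p.snd t.snd = inner ℝ a t.fst)
    (hg : g =ᵐ[volume] Ω.indicator fun x => -(Δ h) x + h x)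
    (hH : H =ᵐ[volume] Ω.indicator h) :
    ‖p.fst - H‖ ≤ 4 * R ^ 2 * ‖a - g‖ +
      (4 * R ^ 2 + 4 * R + 1) * M * ‖hθ.memLp.toLp _‖ := by
  have hU := hθ.isOpen
  have hRU : ∀ x ∈ U, |x i| ≤ R := fun x hx => hR x (hθ.subset hx)
  obtain ⟨e, he, heq⟩ := hθ.exists_mem_H10_mul hh hΩfin
  set d := hθ.memLp.toLp (Ω.indicator fun x => θ x - 1) with hd
  have hdae : d =ᵐ[volume] Ω.indicator fun x => θ x - 1 := MemLp.coeFn_toLp _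
  have hθm : ContinuousOn (fun x => θ x - 1) U := hθ.contDiffOn.continuousOn.sub continuousOn_const
  have hhU := hh.contDiffOn.mono hθ.subset
  have hα : MemLp (U.indicator fun x => (θ x - 1) * (Δ h) x) 2 volume := by
    refine MemLp.of_le_mul (c := M) hθ.memLp ?_ ?_
    · exact (aestronglyMeasurable_indicator_iff hU.measurableSet).2
        ((hθm.mul (contDiffOn_laplacian hU hhU).continuousOn).aestronglyMeasurable hU.measurableSet)
    · refine Eventually.of_forall fun x => ?_
      by_cases hx : x ∈ U
      · rw [indicator_of_mem hx, indicator_of_mem (hθ.subset hx), norm_mul, mul_comm]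
        exact mul_le_mul_of_nonneg_right (hh.bound_laplacian x (hθ.subset hx)) (norm_nonneg _)
      · rw [indicator_of_notMem hx, norm_zero]
        positivity
  have hβ : MemLp (U.indicator fun x => (2 * (θ x - 1)) • gradient h x) 2 volume := by
    refine MemLp.of_le_mul (c := 2 * M) hθ.memLp ?_ ?_
    · exact (aestronglyMeasurable_indicator_iff hU.measurableSet).2
        (((continuousOn_const.mul hθm).smul (continuousOn_gradient hU hhU)).aestronglyMeasurable
          hU.measurableSet)
    · refine Eventually.of_forall fun x => ?_
      by_cases hx : x ∈ U
      · rw [indicator_of_mem hx, indicator_of_mem (hθ.subset hx), norm_smul, norm_mul]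
        have := mul_le_mul_of_nonneg_left (hh.bound_gradient x (hθ.subset hx))
          (norm_nonneg (θ x - 1))
        rw [Real.norm_ofNat]
        linarith
      · rw [indicator_of_notMem hx, norm_zero]
        positivity
  have hαn : ‖hα.toLp _‖ ≤ M * ‖d‖ := by
    refine Lp.norm_le_mul_norm_of_ae_le_mul ?_
    filter_upwards [hα.coeFn_toLp, hdae] with x h1 h2
    rw [h1, h2]
    by_cases hx : x ∈ U
    · rw [indicator_of_mem hx, indicator_of_mem (hθ.subset hx), norm_mul, mul_comm]
      exact mul_le_mul_of_nonneg_right (hh.bound_laplacian x (hθ.subset hx)) (norm_nonneg _)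
    · rw [indicator_of_notMem hx, norm_zero]
      positivity
  have hβn : ‖hβ.toLp _‖ ≤ 2 * M * ‖d‖ := by
    refine Lp.norm_le_mul_norm_of_ae_le_mul ?_
    filter_upwards [hβ.coeFn_toLp, hdae] with x h1 h2
    rw [h1, h2]
    by_cases hx : x ∈ U
    · rw [indicator_of_mem hx, indicator_of_mem (hθ.subset hx), norm_smul, norm_mul]
      have := mul_le_mul_of_nonneg_left (hh.bound_gradient x (hθ.subset hx))
        (norm_nonneg (θ x - 1))
      rw [Real.norm_ofNat]
      linarith
    · rw [indicator_of_notMem hx, norm_zero]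
      positivity
  -- On the holes the product is replaced by zero and the error is `|h| ≤ M`; it is absorbed because
  -- `|θ - 1| ≥ 1` there.
  have heH : ‖e.fst - H‖ ≤ M * ‖d‖ := by
    refine Lp.norm_le_mul_norm_of_ae_le_mul ?_
    filter_upwards [heq, hH, hdae, hθ.le_of_notMem, Lp.coeFn_sub e.fst H] with x h1 h2 h3 h4 h5
    rw [h5, Pi.sub_apply, h1, h2, h3]
    by_cases hxΩ : x ∈ Ω
    · rw [indicator_of_mem hxΩ, indicator_of_mem hxΩ]
      by_cases hx : x ∈ U
      · rw [indicator_of_mem hx, show θ x * h x - h x = h x * (θ x - 1) by ring, norm_mul]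
        exact mul_le_mul_of_nonneg_right (hh.bound x hxΩ) (norm_nonneg _)
      · rw [indicator_of_notMem hx, zero_sub, norm_neg]
        exact (hh.bound x hxΩ).trans (le_mul_of_one_le_right hM0 (h4 hxΩ hx))
    · rw [indicator_of_notMem hxΩ, indicator_of_notMem hxΩ,
        indicator_of_notMem fun hx => hxΩ (hθ.subset hx)]
      simp
  -- The weak equation for `θh`, with `α = (θ - 1)Δh` as function datum and `β = 2(θ - 1)∇h` as
  -- divergence-form datum, both of norm O(`‖θ - 1‖`). It is checked on test functions and extended
  -- by density.
  have hweak : ∀ t ∈ H10 U, inner ℝ e.snd t.snd =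
      inner ℝ g t.fst + inner ℝ (hα.toLp _) t.fst + inner ℝ (hβ.toLp _) t.snd := by
    intro t ht
    refine H10_induction (P := fun t : PairL2 n => inner ℝ e.snd t.snd =
      inner ℝ g t.fst + inner ℝ (hα.toLp _) t.fst + inner ℝ (hβ.toLp _) t.snd) ?_ ?_ ht
    · exact isClosed_eq (continuous_const.inner continuous_snd)
        (((continuous_const.inner continuous_fst).add (continuous_const.inner continuous_fst)).add
          (continuous_const.inner continuous_snd))
    · intro φ hφ
      have h0 := inner_snd_gradient hφ he
      have hU0 := fun t ht => ae_eq_zero_of_mem_H10 (U := U) hU.measurableSet (p := t) ht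
      have hφm := testPairs_le_H10 U hφ.mkPair_mem
      have hΔm := testPairs_le_H10 U hφ.laplacian.mkPair_mem
      have k1 := inner_eq_setIntegral hU.measurableSet e.fst _ (hU0 _ hΔm).1
      have k2 := inner_eq_setIntegral hU.measurableSet g _ (hU0 _ hφm).1
      have k3 := inner_eq_setIntegral hU.measurableSet (hα.toLp _) _ (hU0 _ hφm).1
      have k4 := inner_eq_setIntegral hU.measurableSet (hβ.toLp _) _ (hU0 _ hφm).2
      change inner ℝ e.snd (hφ.memLp_gradient.toLp (gradient φ)) = _
      rw [h0]
      have i1 := (L2.integrable_inner (𝕜 := ℝ) e.fst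
        (mkPair hφ.laplacian.memLp hφ.laplacian.memLp_gradient).fst).integrableOn (s := U)
      have i2 := (L2.integrable_inner (𝕜 := ℝ) g
        (mkPair hφ.memLp hφ.memLp_gradient).fst).integrableOn (s := U)
      have i3 := (L2.integrable_inner (𝕜 := ℝ) (hα.toLp _)
        (mkPair hφ.memLp hφ.memLp_gradient).fst).integrableOn (s := U)
      have i4 := (L2.integrable_inner (𝕜 := ℝ) (hβ.toLp _)
        (mkPair hφ.memLp hφ.memLp_gradient).snd).integrableOn (s := U)
      have hsum : inner ℝ e.fst (hφ.laplacian.memLp.toLp (Δ φ)) +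
          inner ℝ g (mkPair hφ.memLp hφ.memLp_gradient).fst +
          inner ℝ (hα.toLp _) (mkPair hφ.memLp hφ.memLp_gradient).fst +
          inner ℝ (hβ.toLp _) (mkPair hφ.memLp hφ.memLp_gradient).snd = 0 := by
        change inner ℝ e.fst (mkPair hφ.laplacian.memLp hφ.laplacian.memLp_gradient).fst + _ + _ + _
          = 0
        rw [k1, k2, k3, k4, ← integral_add' i1 i2, ← integral_add' (i1.add i2) i3,
          ← integral_add' ((i1.add i2).add i3) i4, ← hθ.classical_identity hh hφ]
        refine integral_congr_ae ?_
        filter_upwards [ae_restrict_mem hU.measurableSet, ae_restrict_of_ae heq,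
          ae_restrict_of_ae hg, ae_restrict_of_ae hα.coeFn_toLp, ae_restrict_of_ae hβ.coeFn_toLp,
          ae_restrict_of_ae (mkPair_fst_ae hφ.memLp hφ.memLp_gradient),
          ae_restrict_of_ae (mkPair_snd_ae hφ.memLp hφ.memLp_gradient),
          ae_restrict_of_ae (mkPair_fst_ae hφ.laplacian.memLp hφ.laplacian.memLp_gradient)]
          with x hx h1 h2 h3 h4 h5 h6 h7
        simp only [Pi.add_apply]
        rw [h1, h2, h3, h4, h5, h6, h7, indicator_of_mem hx, indicator_of_mem (hθ.subset hx),
          indicator_of_mem hx, indicator_of_mem hx, real_inner_smul_left]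
        simp only [RCLike.inner_apply, conj_trivial]
        ring
      linarith
  -- The difference of `p` and `θh` solves a Dirichlet problem on `U` with small data, so the
  -- constant depends on `R` only and not on the perforation.
  have hr := norm_fst_le_of_weak i hR0 hRU (Submodule.sub_mem _ hp he)
    (a - g - hα.toLp _) (-hβ.toLp _) (fun t ht => by
      rw [WithLp.sub_snd, inner_sub_left, hpa t ht, hweak t ht, inner_sub_left, inner_sub_left,
        inner_neg_left]
      ring)
  rw [WithLp.sub_fst, norm_neg] at hr
  have h1 : ‖p.fst - H‖ ≤ ‖p.fst - e.fst‖ + ‖e.fst - H‖ := norm_sub_le_norm_sub_add_norm_sub _ _ _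
  have h2 : ‖a - g - hα.toLp _‖ ≤ ‖a - g‖ + ‖hα.toLp _‖ := _root_.norm_sub_le _ _
  have h3 : 2 * R * (2 * R * ‖a - g - hα.toLp _‖ + ‖hβ.toLp _‖) ≤
      2 * R * (2 * R * (‖a - g‖ + M * ‖d‖) + 2 * M * ‖d‖) := by
    gcongr
    exact h2.trans (by gcongr)
  nlinarith

/-! ### The logarithmic potential of a disc. -/

section LogPotential

/-- In polar coordinates the density is `r log² r = log r · (r log r)`, an integrable function times
a continuous one. -/
lemma integrableOn_log_norm_sq (R : ℝ) :
    IntegrableOn (fun q : ℂ => Real.log ‖q‖ ^ 2) (Metric.ball 0 R) volume := by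
  rw [integrableOn_fun_norm_addHaar volume (f := fun r => Real.log r ^ 2)]
  have h : IntervalIntegrable (fun y => Real.log y * (y * Real.log y)) volume 0 R :=
    intervalIntegral.intervalIntegrable_log'.mul_continuousOn Real.continuous_mul_log.continuousOn
  rcases le_total 0 R with hR | hR
  · rw [intervalIntegrable_iff_integrableOn_Ioo_of_le hR] at h
    refine h.congr_fun (fun y _ => ?_) measurableSet_Ioo
    simp only [Complex.finrank_real_complex, smul_eq_mul]
    ring
  · simp [Ioo_eq_empty_of_le hR]

/-- Reflecting and translating by `ζ` carries the disc into the disc of radius `2R`. The point is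
that the bound does not depend on `ζ`. -/
lemma integrableOn_log_norm_sub_sq {R : ℝ} {ζ : ℂ} (hζ : ‖ζ‖ < R) :
    IntegrableOn (fun p : ℂ => Real.log ‖ζ - p‖ ^ 2) (Metric.ball 0 R) volume ∧
    ∫ p in Metric.ball (0 : ℂ) R, Real.log ‖ζ - p‖ ^ 2 ≤
      ∫ q in Metric.ball (0 : ℂ) (2 * R), Real.log ‖q‖ ^ 2 := by
  have hmp : MeasurePreserving (fun p : ℂ => ζ - p) volume volume :=
    Measure.measurePreserving_sub_left volume ζ
  have hme : MeasurableEmbedding (fun p : ℂ => ζ - p) :=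
    (MeasurableEquiv.subLeft ζ).measurableEmbedding
  have hsub : Metric.ball (0 : ℂ) R ⊆ (fun p => ζ - p) ⁻¹' Metric.ball 0 (2 * R) := by
    intro p hp
    rw [mem_ball_zero_iff] at hp
    rw [mem_preimage, mem_ball_zero_iff]
    linarith [norm_sub_le ζ p]
  have h1 : IntegrableOn (fun p : ℂ => Real.log ‖ζ - p‖ ^ 2)
      ((fun p => ζ - p) ⁻¹' Metric.ball 0 (2 * R)) volume :=
    (hmp.integrableOn_comp_preimage hme).2 (integrableOn_log_norm_sq (2 * R))
  refine ⟨h1.mono_set hsub, ?_⟩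
  rw [← hmp.setIntegral_preimage_emb hme (fun q => Real.log ‖q‖ ^ 2) (Metric.ball 0 (2 * R))]
  exact setIntegral_mono_set h1 (Eventually.of_forall fun p => sq_nonneg _) hsub.eventuallyLE

lemma integrableOn_log_norm_sub {R : ℝ} {ζ : ℂ} (hζ : ‖ζ‖ < R) :
    IntegrableOn (fun p : ℂ => Real.log ‖ζ - p‖) (Metric.ball 0 R) volume := by
  have hm : Measurable (fun p : ℂ => Real.log ‖ζ - p‖) := by fun_prop
  have h : MemLp (fun p : ℂ => Real.log ‖ζ - p‖) 2 (volume.restrict (Metric.ball 0 R)) :=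
    (memLp_two_iff_integrable_sq hm.aestronglyMeasurable).2 (integrableOn_log_norm_sub_sq hζ).1
  have : IsFiniteMeasure (volume.restrict (Metric.ball (0 : ℂ) R)) :=
    ⟨by rw [Measure.restrict_apply_univ]; exact measure_ball_lt_top⟩
  exact h.integrable (by norm_num)

/-- The average of `log |ζ - p|` over the disc of radius `R`. -/
def discPotential (R : ℝ) (ζ : ℂ) : ℝ := Real.log R + (‖ζ‖ ^ 2 - R ^ 2) / (2 * R ^ 2)

lemma integral_mul_log {a b : ℝ} (ha : 0 ≤ a) (hab : a ≤ b) :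
    ∫ r in a..b, r * Real.log r =
      (b ^ 2 * Real.log b / 2 - b ^ 2 / 4) - (a ^ 2 * Real.log a / 2 - a ^ 2 / 4) := by
  refine intervalIntegral.integral_eq_sub_of_hasDerivAt_of_le hab
    (f := fun r => r ^ 2 * Real.log r / 2 - r ^ 2 / 4) ?_ ?_ ?_
  · have : (fun r : ℝ => r ^ 2 * Real.log r / 2 - r ^ 2 / 4) =
        fun r => r * (r * Real.log r) / 2 - r ^ 2 / 4 := by
      ext r; ring
    rw [this]
    exact (((continuous_id.mul Real.continuous_mul_log).div_const 2).sub
      ((continuous_pow 2).div_const 4)).continuousOn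
  · intro r hr
    have hr0 : r ≠ 0 := (ha.trans_lt hr.1).ne'
    have h := (((hasDerivAt_pow 2 r).mul (Real.hasDerivAt_log hr0)).div_const 2).sub
      ((hasDerivAt_pow 2 r).div_const 4)
    refine h.congr_deriv ?_
    field_simp
    norm_num
    ring
  · exact Real.continuous_mul_log.intervalIntegrable _ _

/-- The bracket equals `log (max r ρ)` for positive `r` and `ρ`, so the integral splits at `ρ` into
a multiple of `r` and `r log r`. -/
lemma integral_radial {ρ R : ℝ} (hρ : 0 ≤ ρ) (hρR : ρ ≤ R) :
    ∫ r in (0 : ℝ)..R, r * (Real.log r + Real.posLog (r⁻¹ * ρ)) =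
      R ^ 2 * Real.log R / 2 + (ρ ^ 2 - R ^ 2) / 4 := by
  have e1 : EqOn (fun r => r * (Real.log r + Real.posLog (r⁻¹ * ρ))) (fun r => r * Real.log ρ)
      (uIcc 0 ρ) := by
    intro r hr
    rw [uIcc_of_le hρ] at hr
    rcases hr.1.eq_or_lt with h0 | h0
    · simp [← h0]
    · have hρ0 : 0 < ρ := h0.trans_le hr.2
      have : 1 ≤ r⁻¹ * ρ := by
        rw [inv_mul_eq_div, le_div_iff₀ h0]; linarith [hr.2]
      simp only
      rw [Real.posLog_eq_log (by rwa [abs_of_nonneg (by positivity)]),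
        Real.log_mul (by positivity) (by positivity), Real.log_inv]
      ring
  have e2 : EqOn (fun r => r * (Real.log r + Real.posLog (r⁻¹ * ρ))) (fun r => r * Real.log r)
      (uIcc ρ R) := by
    intro r hr
    rw [uIcc_of_le hρR] at hr
    have hr0 : 0 ≤ r := hρ.trans hr.1
    rcases hr0.eq_or_lt with h0 | h0
    · simp [← h0]
    · have : r⁻¹ * ρ ≤ 1 := by
        rw [inv_mul_eq_div, div_le_iff₀ h0]; linarith [hr.1]
      simp only
      rw [(Real.posLog_eq_zero_iff _).2 (by rwa [abs_of_nonneg (by positivity)]), add_zero]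
  have i1 : IntervalIntegrable (fun r => r * (Real.log r + Real.posLog (r⁻¹ * ρ))) volume 0 ρ :=
    (intervalIntegrable_congr (e1.mono uIoc_subset_uIcc)).2
      ((continuous_id.mul continuous_const).intervalIntegrable _ _)
  have i2 : IntervalIntegrable (fun r => r * (Real.log r + Real.posLog (r⁻¹ * ρ))) volume ρ R :=
    (intervalIntegrable_congr (e2.mono uIoc_subset_uIcc)).2
      (Real.continuous_mul_log.intervalIntegrable _ _)
  rw [← intervalIntegral.integral_add_adjacent_intervals i1 i2,
    intervalIntegral.integral_congr e1, intervalIntegral.integral_congr e2,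
    integral_mul_log hρ hρR, intervalIntegral.integral_mul_const, integral_id]
  ring

/-- Jensen's formula for one linear factor: the mean of `log |z - ζ|` over the circle of radius `r`,
rewritten in the parametrization of polar coordinates. -/
lemma integral_angular {ζ : ℂ} {r : ℝ} (hr : r ≠ 0) :
    ∫ t in Ioo (-Real.pi) Real.pi, Real.log ‖ζ - Complex.polarCoord.symm (r, t)‖ =
      2 * Real.pi * (Real.log r + Real.posLog (r⁻¹ * ‖ζ‖)) := by
  have h := Real.circleAverage_eq_integral_add (f := fun z : ℂ => Real.log ‖z - ζ‖) (c := 0)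
    (R := r) (-Real.pi)
  rw [circleAverage_log_norm_sub_const_eq_log_radius_add_posLog hr, zero_sub, norm_neg,
    intervalIntegral.integral_comp_add_right
      (fun t => Real.log ‖circleMap 0 r t - ζ‖) (-Real.pi)] at h
  rw [h, smul_eq_mul, ← mul_assoc, mul_inv_cancel₀ (by positivity), one_mul,
    show (0 : ℝ) + -Real.pi = -Real.pi by ring, show 2 * Real.pi + -Real.pi = Real.pi by ring,
    intervalIntegral.integral_of_le (by linarith [Real.pi_pos]), integral_Ioc_eq_integral_Ioo]
  refine integral_congr_ae (Eventually.of_forall fun t => ?_)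
  simp only
  rw [norm_sub_rev, Complex.polarCoord_symm_apply, circleMap_zero, Complex.exp_mul_I]
  push_cast
  rfl

/-- The logarithmic potential of a disc. -/
lemma integral_log_norm_sub {R : ℝ} {ζ : ℂ} (hζ : ‖ζ‖ < R) :
    ∫ p in Metric.ball (0 : ℂ) R, Real.log ‖ζ - p‖ = Real.pi * R ^ 2 * discPotential R ζ := by
  have hR : 0 < R := (norm_nonneg _).trans_lt hζ
  set f : ℂ → ℝ := (Metric.ball (0 : ℂ) R).indicator fun p => Real.log ‖ζ - p‖ with hf
  have hfm : Measurable f := by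
    have : Measurable fun p : ℂ => Real.log ‖ζ - p‖ := by fun_prop
    exact this.indicator measurableSet_ball
  have hfi : Integrable f := (integrable_indicator_iff measurableSet_ball).2
    (integrableOn_log_norm_sub hζ)
  have hpm : Measurable (fun p : ℝ × ℝ => (Complex.polarCoord.symm p : ℂ)) := by
    simp only [Complex.polarCoord_symm_apply]
    fun_prop
  have hgi : IntegrableOn (fun p : ℝ × ℝ => p.1 • f (Complex.polarCoord.symm p))
      (Ioi (0 : ℝ) ×ˢ Ioo (-Real.pi) Real.pi) volume := by
    refine ⟨(measurable_fst.smul (hfm.comp hpm)).aestronglyMeasurable, ?_⟩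
    have h1 := hfi.2
    rw [HasFiniteIntegral, ← Complex.lintegral_comp_polarCoord_symm] at h1
    rw [HasFiniteIntegral]
    refine lt_of_le_of_lt (le_of_eq ?_) h1
    refine setLIntegral_congr_fun (measurableSet_Ioi.prod measurableSet_Ioo) fun p hp => ?_
    rw [enorm_smul, Real.enorm_of_nonneg (le_of_lt hp.1), smul_eq_mul]
  rw [← integral_indicator measurableSet_ball, ← hf, ← Complex.integral_comp_polarCoord_symm]
  change ∫ p in Ioi (0 : ℝ) ×ˢ Ioo (-Real.pi) Real.pi, p.1 • f (Complex.polarCoord.symm p) = _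
  rw [Measure.volume_eq_prod, setIntegral_prod _ hgi]
  have hin : ∀ r ∈ Ioi (0 : ℝ), ∫ t in Ioo (-Real.pi) Real.pi,
      r • f (Complex.polarCoord.symm (r, t)) =
      (Iio R).indicator (fun r => 2 * Real.pi *
        (r * (Real.log r + Real.posLog (r⁻¹ * ‖ζ‖)))) r := by
    intro r hr
    have hnorm : ∀ t, ‖Complex.polarCoord.symm (r, t)‖ = r := fun t => by
      rw [Complex.norm_polarCoord_symm]; exact abs_of_pos hr
    by_cases hrR : r < R
    · rw [indicator_of_mem (show r ∈ Iio R from hrR)]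
      have : ∀ t, f (Complex.polarCoord.symm (r, t)) =
          Real.log ‖ζ - Complex.polarCoord.symm (r, t)‖ := fun t =>
        indicator_of_mem (by rw [mem_ball_zero_iff, hnorm]; exact hrR) _
      simp only [this, smul_eq_mul]
      rw [integral_const_mul, integral_angular (ne_of_gt hr)]
      ring
    · rw [indicator_of_notMem (show r ∉ Iio R from hrR)]
      have : ∀ t, f (Complex.polarCoord.symm (r, t)) = 0 := fun t =>
        indicator_of_notMem (by rw [mem_ball_zero_iff, hnorm]; exact hrR) _
      simp only [this, smul_zero, integral_zero]
  rw [setIntegral_congr_fun measurableSet_Ioi hin, setIntegral_indicator measurableSet_Iio,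
    Ioi_inter_Iio, ← integral_Ioc_eq_integral_Ioo, ← intervalIntegral.integral_of_le hR.le,
    intervalIntegral.integral_const_mul, integral_radial (norm_nonneg _) hζ.le, discPotential]
  field_simp
  ring

end LogPotential

/-! ### Approximation of the disc potential by finitely many poles. -/

section Approximation

universe u

variable {α : Type u} [MeasurableSpace α] {μ : Measure α} [IsFiniteMeasure μ] {T : α → ℂ} {R : ℝ}

lemma continuous_discPotential (R : ℝ) : Continuous (discPotential R) := by
  unfold discPotential
  fun_prop

lemma memLp_discPotential (hT : Measurable T) (hTR : ∀ᵐ x ∂μ, ‖T x‖ < R) :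
    MemLp (fun x => discPotential R (T x)) 2 μ := by
  obtain ⟨C, hC⟩ := (isCompact_closedBall (0 : ℂ) R).exists_bound_of_continuousOn
    (continuous_discPotential R).continuousOn
  refine MemLp.of_bound ((continuous_discPotential R).measurable.comp hT).aestronglyMeasurable C ?_
  filter_upwards [hTR] with x hx
  exact hC _ (by simpa using hx.le)

/-- The integral in `p` is bounded uniformly in `x` and `μ` is finite. Square integrability on the
product is what permits Fubini against an arbitrary L² function. -/
lemma memLp_prod_log (hT : Measurable T) (hTR : ∀ᵐ x ∂μ, ‖T x‖ < R) :
    MemLp (fun z : ℂ × α => Real.log ‖T z.2 - z.1‖) 2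
      ((volume.restrict (Metric.ball (0 : ℂ) R)).prod μ) := by
  have hm : Measurable (fun z : ℂ × α => Real.log ‖T z.2 - z.1‖) := by fun_prop
  rw [memLp_two_iff_integrable_sq hm.aestronglyMeasurable,
    integrable_prod_iff' (hm.pow_const 2).aestronglyMeasurable]
  constructor
  · filter_upwards [hTR] with x hx using (integrableOn_log_norm_sub_sq hx).1
  · refine Integrable.of_bound (C := ∫ q in Metric.ball (0 : ℂ) (2 * R), Real.log ‖q‖ ^ 2) ?_ ?_
    · exact ((hm.pow_const 2).norm.stronglyMeasurable.integral_prod_left').aestronglyMeasurable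
    · filter_upwards [hTR] with x hx
      rw [Real.norm_of_nonneg (integral_nonneg fun _ => norm_nonneg _)]
      simp only [norm_pow, Real.norm_eq_abs, sq_abs]
      exact (integrableOn_log_norm_sub_sq hx).2

/-- The potential of the disc lies in the closed convex hull of the potentials of its points. -/
lemma discPotential_mem_closure (hT : Measurable T) (hR : 0 < R) (hTR : ∀ᵐ x ∂μ, ‖T x‖ < R) :
    (memLp_discPotential hT hTR).toLp _ ∈ closure (convexHull ℝ {g : Lp ℝ 2 μ |
      ∃ p ∈ Metric.ball (0 : ℂ) R, g =ᵐ[μ] fun x => Real.log ‖T x - p‖}) := by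
  by_contra hmem
  -- A functional strictly separating the disc potential from the hull is at most `s` on each point
  -- potential; averaging over the poles by Fubini makes it at most `s` on the disc potential, a
  -- contradiction.
  obtain ⟨ℓ, s, hs, hsψ⟩ := geometric_hahn_banach_closed_point (convex_convexHull ℝ _).closure
    isClosed_closure hmem
  set g : Lp ℝ 2 μ := (InnerProductSpace.toDual ℝ (Lp ℝ 2 μ)).symm ℓ with hg
  have hℓ : ∀ (a : Lp ℝ 2 μ) (f : α → ℝ), a =ᵐ[μ] f → ℓ a = ∫ x, f x * g x ∂μ := by
    intro a f haf
    rw [← InnerProductSpace.toDual_symm_apply, ← hg, L2.inner_def]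
    refine integral_congr_ae ?_
    filter_upwards [haf] with x hx
    rw [hx]
    rfl
  set ν := volume.restrict (Metric.ball (0 : ℂ) R) with hν
  have : IsFiniteMeasure ν :=
    ⟨by rw [hν, Measure.restrict_apply_univ]; exact measure_ball_lt_top⟩
  have hνr : ν.real univ = Real.pi * R ^ 2 := by
    rw [hν, measureReal_restrict_apply_univ, measureReal_def, Complex.volume_ball]
    simp [hR.le]
    ring
  have hk := memLp_prod_log hT hTR
  have hgp : MemLp (fun z : ℂ × α => g z.2) 2 (ν.prod μ) := (Lp.memLp g).comp_snd ν
  have hF : Integrable (fun z : ℂ × α => Real.log ‖T z.2 - z.1‖ * g z.2) (ν.prod μ) :=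
    MemLp.integrable_mul (p := 2) (q := 2) hk hgp
  have hkp : ∀ᵐ p ∂ν, MemLp (fun x => Real.log ‖T x - p‖) 2 μ := by
    have hm : Measurable (fun z : ℂ × α => Real.log ‖T z.2 - z.1‖) := by fun_prop
    have := ((memLp_two_iff_integrable_sq hm.aestronglyMeasurable).1 hk).prod_right_ae
    filter_upwards [this] with p hp
    have hmp : Measurable (fun x => Real.log ‖T x - p‖) := by fun_prop
    exact (memLp_two_iff_integrable_sq hmp.aestronglyMeasurable).2 hp
  have hlt : ∀ᵐ p ∂ν, ∫ x, Real.log ‖T x - p‖ * g x ∂μ ≤ s := by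
    filter_upwards [hkp, ae_restrict_mem measurableSet_ball] with p hp hpR
    rw [← hℓ _ _ hp.coeFn_toLp]
    exact (hs _ (subset_closure (subset_convexHull ℝ _ ⟨p, hpR, hp.coeFn_toLp⟩))).le
  have h1 : ∫ p, ∫ x, Real.log ‖T x - p‖ * g x ∂μ ∂ν ≤ ∫ _, s ∂ν :=
    integral_mono_ae hF.integral_prod_left (integrable_const s) hlt
  rw [integral_integral_swap hF, integral_const, hνr, smul_eq_mul] at h1
  have h2 : ∫ x, ∫ p, Real.log ‖T x - p‖ * g x ∂ν ∂μ =
      Real.pi * R ^ 2 * ∫ x, discPotential R (T x) * g x ∂μ := by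
    rw [← integral_const_mul]
    refine integral_congr_ae ?_
    filter_upwards [hTR] with x hx
    rw [integral_mul_const, hν, integral_log_norm_sub hx, mul_assoc]
  rw [h2, ← hℓ _ _ (memLp_discPotential hT hTR).coeFn_toLp] at h1
  have h3 : 0 < Real.pi * R ^ 2 := by positivity
  exact absurd (le_of_mul_le_mul_left h1 h3) (not_le.2 hsψ)

/-- A point of the convex hull close to the disc potential is a finite combination with strictly
positive weights. Positivity, not the sum of the weights, is what the corrector needs. -/
lemma exists_log_approximation (hT : Measurable T) (hR : 0 < R) (hTR : ∀ᵐ x ∂μ, ‖T x‖ < R)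
    {ε : ℝ} (hε : 0 < ε) :
    ∃ (ι : Type u) (_ : Fintype ι) (c : ι → ℝ) (p : ι → ℂ), (∀ i, 0 < c i) ∧
      (∀ i, ‖p i‖ < R) ∧
      MemLp (fun x => ∑ i, c i * Real.log ‖T x - p i‖ - discPotential R (T x)) 2 μ ∧
      (eLpNorm (fun x => ∑ i, c i * Real.log ‖T x - p i‖ - discPotential R (T x)) 2 μ).toReal
        < ε := by
  obtain ⟨b, hb, hdist⟩ := Metric.mem_closure_iff.1 (discPotential_mem_closure hT hR hTR) ε hε
  obtain ⟨ι, hι, z, c, hz, -, hc, -, hsum⟩ := eq_pos_convex_span_of_mem_convexHull hb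
  choose p hpR hp using fun i => hz (mem_range_self i)
  have hae : (b - (memLp_discPotential hT hTR).toLp _ : Lp ℝ 2 μ) =ᵐ[μ]
      fun x => ∑ i, c i * Real.log ‖T x - p i‖ - discPotential R (T x) := by
    have h1 : b =ᵐ[μ] fun x => ∑ i, c i * Real.log ‖T x - p i‖ := by
      rw [← hsum]
      have h2 : ∀ᵐ x ∂μ, ∀ i, (c i • z i : Lp ℝ 2 μ) x = c i * Real.log ‖T x - p i‖ := by
        refine ae_all_iff.2 fun i => ?_
        filter_upwards [hp i, Lp.coeFn_smul (c i) (z i)] with x h3 h4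
        rw [h4, Pi.smul_apply, h3, smul_eq_mul]
      filter_upwards [Lp.coeFn_finsetSum Finset.univ (fun i => c i • z i), h2] with x h3 h4
      rw [h3, Finset.sum_apply]
      exact Finset.sum_congr rfl fun i _ => h4 i
    filter_upwards [h1, (memLp_discPotential hT hTR).coeFn_toLp,
      Lp.coeFn_sub b ((memLp_discPotential hT hTR).toLp _)] with x h3 h4 h5
    rw [h5, Pi.sub_apply, h3, h4]
  refine ⟨ι, hι, c, p, hc, fun i => by simpa using hpR i, (memLp_congr_ae hae).1 (Lp.memLp _), ?_⟩
  rw [← eLpNorm_congr_ae hae, ← Lp.norm_def, ← dist_eq_norm, dist_comm]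
  exact hdist

end Approximation

/-! ### Construction of perforated domains and correctors. -/

section Corrector

/-- The projection `x ↦ xᵢ + √-1 xⱼ` onto a coordinate plane. -/
def planeProj (i j : Fin n) : EuclideanSpace ℝ (Fin n) →L[ℝ] ℂ :=
  (EuclideanSpace.proj i : EuclideanSpace ℝ (Fin n) →L[ℝ] ℝ).smulRight (1 : ℂ) +
    (EuclideanSpace.proj j : EuclideanSpace ℝ (Fin n) →L[ℝ] ℝ).smulRight Complex.I

lemma planeProj_apply (i j : Fin n) (x : EuclideanSpace ℝ (Fin n)) :
    planeProj i j x = x i + x j * Complex.I := by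
  simp [planeProj]

/-- The projection sends two basis vectors to `1` and `Complex.I` and kills the others, so planar
functions lift with the same Laplacian; holes become cylinders. -/
lemma laplacian_comp_planeProj {i j : Fin n} (hij : i ≠ j) {g : ℂ → ℝ}
    {x : EuclideanSpace ℝ (Fin n)} (hg : ContDiffAt ℝ 2 g (planeProj i j x)) :
    (Δ (fun y => g (planeProj i j y))) x = (Δ g) (planeProj i j x) := by
  rw [InnerProductSpace.laplacian_eq_iteratedFDeriv_orthonormalBasis _
    (EuclideanSpace.basisFun (Fin n) ℝ), InnerProductSpace.laplacian_eq_iteratedFDeriv_complexPlane]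
  have hd : DifferentiableAt ℝ (fderiv ℝ g) (planeProj i j x) :=
    (hg.fderiv_right (m := 1) (by norm_num)).differentiableAt (by simp)
  have h0 : fderiv ℝ (fun y => g (planeProj i j y)) =ᶠ[𝓝 x] fun y =>
      (fderiv ℝ g (planeProj i j y)).comp (planeProj i j) := by
    have h1 : ∀ᶠ z in 𝓝 (planeProj i j x), DifferentiableAt ℝ g z :=
      (hg.eventually (by simp)).mono fun z hz => hz.differentiableAt (by simp)
    filter_upwards [(planeProj i j).continuous.continuousAt.eventually h1] with y hy
    exact (hy.hasFDerivAt.comp y (planeProj i j).hasFDerivAt).fderiv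
  have h2 : ∀ v, fderiv ℝ (fderiv ℝ fun y => g (planeProj i j y)) x v v =
      fderiv ℝ (fderiv ℝ g) (planeProj i j x) (planeProj i j v) (planeProj i j v) := by
    intro v
    rw [h0.fderiv_eq]
    have h3 := ((ContinuousLinearMap.compL ℝ (EuclideanSpace ℝ (Fin n)) ℂ ℝ).flip
      (planeProj i j)).hasFDerivAt.comp x (hd.hasFDerivAt.comp x (planeProj i j).hasFDerivAt)
    change HasFDerivAt (fun y => (fderiv ℝ g (planeProj i j y)).comp (planeProj i j)) _ x at h3
    rw [h3.fderiv]
    rfl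
  simp only [iteratedFDeriv_two_apply, EuclideanSpace.basisFun_apply, Matrix.cons_val_zero,
    Matrix.cons_val_one, h2]
  have hi : planeProj i j (EuclideanSpace.single i 1) = 1 := by
    simp [planeProj_apply, hij]
  have hj : planeProj i j (EuclideanSpace.single j 1) = Complex.I := by
    simp [planeProj_apply, hij.symm]
  rw [Finset.sum_eq_add_of_mem i j (Finset.mem_univ _) (Finset.mem_univ _) hij, hi, hj]
  intro k _ hk
  have : planeProj i j (EuclideanSpace.single k 1) = 0 := by
    simp [planeProj_apply, hk.1.symm, hk.2.symm]
  rw [this]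
  simp

/-- The fibre lies in the hyperplane where the `i`-th coordinate equals `p.re`. -/
lemma volume_planeProj_eq (i j : Fin n) (p : ℂ) :
    volume {x : EuclideanSpace ℝ (Fin n) | planeProj i j x = p} = 0 := by
  have h1 : (volume : Measure (Fin n → ℝ)) {f | f i = p.re} = 0 := by
    rw [volume_pi]
    exact Measure.pi_hyperplane (fun _ : Fin n => (volume : Measure ℝ)) i p.re
  have h2 := (PiLp.volume_preserving_ofLp (Fin n)).quasiMeasurePreserving.preimage_null h1
  refine measure_mono_null (fun x hx => ?_) h2
  have h3 := congrArg Complex.re (show planeProj i j x = p from hx)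
  rw [planeProj_apply] at h3
  simpa using h3

lemma laplacian_norm_sq_complex (ζ : ℂ) : (Δ fun z : ℂ => ‖z‖ ^ 2) ζ = 4 := by
  let B : ℂ →L[ℝ] ℂ →L[ℝ] ℝ :=
    (isBoundedBilinearMap_inner (𝕜 := ℝ) (E := ℂ)).toContinuousLinearMap
  have hB : fderiv ℝ (fun z : ℂ => ‖z‖ ^ 2) = fun z => ((2 : ℝ) • B) z := by
    ext z v
    rw [fderiv_norm_sq_apply]
    simp [B]
    ring
  rw [InnerProductSpace.laplacian_eq_iteratedFDeriv_complexPlane]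
  simp only [iteratedFDeriv_two_apply, hB, ContinuousLinearMap.fderiv, Matrix.cons_val_zero,
    Matrix.cons_val_one]
  change 2 * inner ℝ (1 : ℂ) 1 + 2 * inner ℝ Complex.I Complex.I = (4 : ℝ)
  simp
  norm_num

variable {ι : Type*} [Fintype ι] {c : ι → ℝ} {p : ι → ℂ}

/-- A function with Laplacian `-1` off the poles `pᵢ`, tending to `-∞` at the poles when all the
weights `cᵢ` are positive. -/
def polarCorrector (R : ℝ) (c : ι → ℝ) (p : ι → ℂ) (ζ : ℂ) : ℝ :=
  1 + R ^ 2 / 2 * (∑ i, c i * Real.log ‖ζ - p i‖ - discPotential R ζ)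

lemma contDiffAt_polarCorrector (R : ℝ) {ζ : ℂ} (hζ : ∀ i, ζ ≠ p i) :
    ContDiffAt ℝ ∞ (polarCorrector R c p) ζ := by
  unfold polarCorrector discPotential
  refine contDiffAt_const.add (contDiffAt_const.mul (ContDiffAt.sub ?_ ?_))
  · refine ContDiffAt.sum fun i _ => contDiffAt_const.mul ?_
    have h : ζ - p i ≠ 0 := sub_ne_zero.2 (hζ i)
    exact ((contDiffAt_id.sub contDiffAt_const).norm ℝ h).log (norm_ne_zero_iff.2 h)
  · exact contDiffAt_const.add
      (((contDiff_norm_sq ℝ).contDiffAt.sub contDiffAt_const).div_const _)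

/-- The logarithms are harmonic off the poles, and the disc potential contributes `-‖ζ‖²/4` plus a
constant once multiplied by `-R²/2`. -/
lemma laplacian_polarCorrector {R : ℝ} (hR : R ≠ 0) {ζ : ℂ} (hζ : ∀ i, ζ ≠ p i) :
    (Δ (polarCorrector R c p)) ζ = -1 := by
  have hH : ∀ s : Finset ι, InnerProductSpace.HarmonicAt
      (∑ i ∈ s, c i • fun z : ℂ => Real.log ‖z - p i‖) ζ := by
    intro s
    induction s using Finset.cons_induction with
    | empty =>
      rw [Finset.sum_empty]
      exact InnerProductSpace.harmonicAt_const 0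
    | cons i s hi ih =>
      rw [Finset.sum_cons]
      refine InnerProductSpace.HarmonicAt.add ?_ ih
      refine InnerProductSpace.HarmonicAt.const_smul ?_
      exact AnalyticAt.harmonicAt_log_norm (f := fun z => z - p i) (by fun_prop)
        (sub_ne_zero.2 (hζ i))
  have hH' := (hH Finset.univ).const_smul (c := R ^ 2 / 2)
  have hN : ContDiffAt ℝ 2 (fun z : ℂ => ‖z‖ ^ 2) ζ := (contDiff_norm_sq ℝ).contDiffAt
  have hN' : ContDiffAt ℝ 2 ((-1 / 4 : ℝ) • fun z : ℂ => ‖z‖ ^ 2) ζ := contDiffAt_const.smul hN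
  have hc : ContDiffAt ℝ 2 (fun _ : ℂ => 1 - R ^ 2 / 2 * Real.log R + R ^ 2 / 4) ζ :=
    contDiffAt_const
  have e : polarCorrector R c p = ((R ^ 2 / 2) • ∑ i, c i • fun z : ℂ => Real.log ‖z - p i‖) +
      ((-1 / 4 : ℝ) • fun z : ℂ => ‖z‖ ^ 2) +
      fun _ : ℂ => 1 - R ^ 2 / 2 * Real.log R + R ^ 2 / 4 := by
    ext z
    simp only [polarCorrector, discPotential, Pi.add_apply, Pi.smul_apply, Finset.sum_apply,
      smul_eq_mul]
    field_simp
    ring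
  have hHN : ContDiffAt ℝ 2 (((R ^ 2 / 2) • ∑ i, c i • fun z : ℂ => Real.log ‖z - p i‖) +
      ((-1 / 4 : ℝ) • fun z : ℂ => ‖z‖ ^ 2)) ζ := hH'.1.add hN'
  rw [e, hHN.laplacian_add hc, hH'.1.laplacian_add hN',
    InnerProductSpace.laplacian_smul _ hN, laplacian_norm_sq_complex]
  have h0 : (Δ ((R ^ 2 / 2) • ∑ i, c i • fun z : ℂ => Real.log ‖z - p i‖)) ζ = 0 :=
    hH'.2.eq_of_nhds
  rw [h0]
  simp [InnerProductSpace.laplacian_const]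

/-- Where the corrector is positive, the poles are at positive distance. -/
lemma exists_le_norm_sub_of_polarCorrector_pos (hc : ∀ i, 0 < c i) {R : ℝ} (hR : 0 < R)
    (hp : ∀ i, ‖p i‖ < R) :
    ∃ δ > 0, ∀ ζ : ℂ, ‖ζ‖ < R → (∀ i, ζ ≠ p i) → 0 < polarCorrector R c p ζ →
      ∀ i, δ ≤ ‖ζ - p i‖ := by
  obtain ⟨C, hC⟩ := (isCompact_closedBall (0 : ℂ) R).exists_bound_of_continuousOn
    (continuous_discPotential R).continuousOn
  -- If the corrector is positive, `∑ c k * log ‖ζ - p k‖` is bounded below, while each term is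
  -- bounded above through `log (2R)`. Hence every single term is at least `-A`, and its pole cannot
  -- be near.
  set A : ℝ := C + 2 / R ^ 2 + ∑ k, c k * |Real.log (2 * R)| with hA
  have hC0 : 0 ≤ C := (norm_nonneg _).trans (hC 0 (by simpa using hR.le))
  have hA0 : 0 ≤ A := by
    have : 0 ≤ ∑ k, c k * |Real.log (2 * R)| :=
      Finset.sum_nonneg fun k _ => mul_nonneg (hc k).le (abs_nonneg _)
    positivity
  refine ⟨Real.exp (-∑ k, A / c k), Real.exp_pos _, fun ζ hζ hne hpos i => ?_⟩
  have hnp : ∀ k, 0 < ‖ζ - p k‖ := fun k => norm_pos_iff.2 (sub_ne_zero.2 (hne k))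
  rw [← Real.le_log_iff_exp_le (hnp i)]
  have h1 : ∀ k, c k * Real.log ‖ζ - p k‖ ≤ c k * |Real.log (2 * R)| := fun k => by
    refine mul_le_mul_of_nonneg_left (le_trans ?_ (le_abs_self _)) (hc k).le
    exact Real.log_le_log (hnp k) (by linarith [norm_sub_le ζ (p k), hp k])
  have h2 : ∑ k, c k * Real.log ‖ζ - p k‖ ≤
      c i * Real.log ‖ζ - p i‖ + ∑ k, c k * |Real.log (2 * R)| := by
    classical
    rw [← Finset.add_sum_erase _ _ (Finset.mem_univ i)]
    refine add_le_add le_rfl ((Finset.sum_le_sum fun k _ => h1 k).trans ?_)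
    exact Finset.sum_le_sum_of_subset_of_nonneg (Finset.erase_subset _ _)
      fun k _ _ => mul_nonneg (hc k).le (abs_nonneg _)
  have h3 : -(2 / R ^ 2) < ∑ k, c k * Real.log ‖ζ - p k‖ - discPotential R ζ := by
    unfold polarCorrector at hpos
    have hR2 : 0 < R ^ 2 := by positivity
    have : -(2 / R ^ 2) = -1 / (R ^ 2 / 2) := by field_simp
    rw [this, div_lt_iff₀ (by positivity)]
    linarith
  have h4 := (abs_le.1 (hC ζ (by simpa using hζ.le))).1
  have h5 : -A ≤ c i * Real.log ‖ζ - p i‖ := by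
    rw [hA]
    linarith
  have h6 : -(A / c i) ≤ Real.log ‖ζ - p i‖ := by
    rw [← neg_div, div_le_iff₀ (hc i)]
    linarith
  have h7 : A / c i ≤ ∑ k, A / c k :=
    Finset.single_le_sum (f := fun k => A / c k) (fun k _ => div_nonneg hA0 (hc k).le)
      (Finset.mem_univ i)
  linarith

/-- Perforated domains with correctors arbitrarily close to one. -/
lemma exists_isCorrector {Ω : Set (EuclideanSpace ℝ (Fin n))} (hΩ : IsOpen Ω)
    (hb : Bornology.IsBounded Ω) {i j : Fin n} (hij : i ≠ j) {ε : ℝ} (hε : 0 < ε) :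
    ∃ U θ, ∃ hθ : IsCorrector Ω U θ, ‖hθ.memLp.toLp _‖ ≤ ε := by
  set L := planeProj i j with hL
  have : IsFiniteMeasure (volume.restrict Ω) :=
    ⟨by rw [Measure.restrict_apply_univ]; exact hb.measure_lt_top⟩
  obtain ⟨R, hR, hΩR⟩ : ∃ R > 0, ∀ x ∈ Ω, ‖L x‖ < R := by
    obtain ⟨C, hC0, hC⟩ := hb.exists_pos_norm_le
    refine ⟨‖L‖ * C + 1, by positivity, fun x hx => ?_⟩
    have := (L.le_opNorm x).trans (mul_le_mul_of_nonneg_left (hC x hx) (norm_nonneg L))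
    linarith
  obtain ⟨ι, _, c, p, hc, hp, hD, hDε⟩ := exists_log_approximation
    (μ := volume.restrict Ω) L.continuous.measurable hR
    (by filter_upwards [ae_restrict_mem hΩ.measurableSet] with x hx using hΩR x hx)
    (ε := ε / (R ^ 2 / 2)) (by positivity)
  set θ : EuclideanSpace ℝ (Fin n) → ℝ := fun x => polarCorrector R c p (L x) with hθ
  -- The poles must be removed explicitly: `Real.log 0 = 0` gives `θ` a finite and meaningless value
  -- there, possibly positive.
  set W : Set (EuclideanSpace ℝ (Fin n)) := {x | ∀ k, L x ≠ p k} with hW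
  have hWo : IsOpen W := by
    have : W = ⋂ k, {x | L x ≠ p k} := by ext x; simp [hW]
    rw [this]
    exact isOpen_iInter_of_finite fun k => isOpen_ne_fun L.continuous continuous_const
  have hθW : ContDiffOn ℝ ∞ θ W := fun x hx =>
    ((contDiffAt_polarCorrector R hx).comp x L.contDiff.contDiffAt).contDiffWithinAt
  set U : Set (EuclideanSpace ℝ (Fin n)) := {x | x ∈ Ω ∧ x ∈ W ∧ 0 < θ x} with hU
  have hUW : U ⊆ W := fun x hx => hx.2.1
  have hUΩ : U ⊆ Ω := fun x hx => hx.1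
  have hUo : IsOpen U := by
    have : U = Ω ∩ (W ∩ θ ⁻¹' Ioi 0) := by
      ext x
      simp only [hU, Set.mem_ofPred_eq, mem_inter_iff, mem_preimage, mem_Ioi]
    rw [this]
    exact hΩ.inter (hθW.continuousOn.isOpen_inter_preimage hWo isOpen_Ioi)
  obtain ⟨δ, hδ, hδU⟩ := exists_le_norm_sub_of_polarCorrector_pos hc hR hp
  -- A closed set containing `U` on which `θ` is smooth; bounds and compactness are taken on its
  -- intersection with compact sets, since `U` need not be closed in `Ω`.
  set Z : Set (EuclideanSpace ℝ (Fin n)) := {x | ∀ k, δ ≤ ‖L x - p k‖} with hZ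
  have hZc : IsClosed Z := by
    have : Z = ⋂ k, {x | δ ≤ ‖L x - p k‖} := by ext x; simp [hZ]
    rw [this]
    exact isClosed_iInter fun k =>
      isClosed_le continuous_const (L.continuous.sub continuous_const).norm
  have hZW : Z ⊆ W := fun x hx k h => by
    have := hx k
    rw [h, sub_self, norm_zero] at this
    linarith
  have hUZ : U ⊆ Z := fun x hx => hδU _ (hΩR x hx.1) hx.2.1 hx.2.2
  have hcl : IsCompact (closure Ω ∩ Z) := hb.isCompact_closure.inter_right hZc
  have hUcl : U ⊆ closure Ω ∩ Z := fun x hx => ⟨subset_closure hx.1, hUZ hx⟩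
  have hθD : ∀ x, θ x - 1 =
      R ^ 2 / 2 * (∑ k, c k * Real.log ‖L x - p k‖ - discPotential R (L x)) := fun x => by
    simp [hθ, polarCorrector]
  have hC : IsCorrector Ω U θ := by
    refine ⟨hUo, hUΩ, hθW.mono hUW, ?_, ?_, ?_, ?_, ?_⟩
    · obtain ⟨M₁, hM₁⟩ := hcl.exists_bound_of_continuousOn
        (hθW.continuousOn.mono (inter_subset_right.trans hZW))
      obtain ⟨M₂, hM₂⟩ := hcl.exists_bound_of_continuousOn
        ((continuousOn_gradient hWo hθW).mono (inter_subset_right.trans hZW))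
      exact ⟨max M₁ M₂, fun x hx => ⟨(hM₁ x (hUcl hx)).trans (le_max_left _ _),
        (hM₂ x (hUcl hx)).trans (le_max_right _ _)⟩⟩
    · intro x hx
      rw [hθ, hL, laplacian_comp_planeProj hij
        ((contDiffAt_polarCorrector R hx.2.1).of_le (WithTop.coe_le_coe.2 (le_top : (2 : ℕ∞) ≤ ⊤)))]
      exact laplacian_polarCorrector hR.ne' hx.2.1
    · intro K hKΩ hK δ' hδ'
      -- The superlevel set is closed in `K ∩ Z`, and its points belong to `U` because `θ ≥ δ' > 0`
      -- there.
      have h1 := (hθW.continuousOn.mono (inter_subset_right.trans hZW : K ∩ Z ⊆ W)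
        ).preimage_isClosed_of_isClosed (hK.isClosed.inter hZc) (isClosed_Ici (a := δ'))
      convert (hK.inter_right hZc).of_isClosed_subset h1 inter_subset_left using 1
      ext x
      constructor
      · rintro ⟨hx, hxK, hxδ⟩
        rw [abs_of_pos hx.2.2] at hxδ
        exact ⟨⟨hxK, hUZ hx⟩, hxδ⟩
      · rintro ⟨⟨hxK, hxZ⟩, hxδ⟩
        exact ⟨⟨hKΩ hxK, hZW hxZ, hδ'.trans_le hxδ⟩, hxK, le_trans hxδ (le_abs_self _)⟩
    · rw [memLp_indicator_iff_restrict hΩ.measurableSet]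
      simp only [hθD]
      exact hD.const_mul _
    · have h1 : ∀ᵐ x ∂(volume : Measure (EuclideanSpace ℝ (Fin n))), ∀ k, L x ≠ p k := by
        refine ae_all_iff.2 fun k => ?_
        rw [ae_iff]
        simpa using volume_planeProj_eq i j (p k)
      filter_upwards [h1] with x hx hxΩ hxU
      have h2 : θ x ≤ 0 := by
        by_contra! h
        exact hxU ⟨hxΩ, hx, h⟩
      rw [abs_of_nonpos (by linarith)]
      linarith
  refine ⟨U, θ, hC, ?_⟩
  rw [Lp.norm_toLp, eLpNorm_indicator_eq_eLpNorm_restrict hΩ.measurableSet]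
  simp only [hθD]
  have h1 := eLpNorm_const_smul (R ^ 2 / 2)
    (fun x => ∑ k, c k * Real.log ‖L x - p k‖ - discPotential R (L x)) 2 (volume.restrict Ω)
  change eLpNorm (fun x => R ^ 2 / 2 *
    (∑ k, c k * Real.log ‖L x - p k‖ - discPotential R (L x))) 2 (volume.restrict Ω) = _ at h1
  rw [h1, ENNReal.toReal_mul, toReal_enorm, Real.norm_of_nonneg (by positivity)]
  rw [lt_div_iff₀ (by positivity)] at hDε
  linarith

end Corrector

/-! ### Functions with bounded derivatives of all orders. -/

section BoundedDerivatives

variable {Ω : Set (EuclideanSpace ℝ (Fin n))} {b c : EuclideanSpace ℝ (Fin n) → ℝ}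

/-- `b` is smooth in `Ω`, with bounded derivatives of every order. -/
def HasBoundedDerivatives (Ω : Set (EuclideanSpace ℝ (Fin n)))
    (b : EuclideanSpace ℝ (Fin n) → ℝ) : Prop :=
  ContDiffOn ℝ ∞ b Ω ∧ ∀ k : ℕ, ∃ C, ∀ x ∈ Ω, ‖iteratedFDeriv ℝ k b x‖ ≤ C

lemma SmoothUpToBoundary.hasBoundedDerivatives (hΩ : Bornology.IsBounded Ω)
    (hb : SmoothUpToBoundary Ω b) : HasBoundedDerivatives Ω b := by
  refine ⟨hb.1, fun k => ?_⟩
  obtain ⟨F, hF, hE⟩ := hb.2.2 k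
  obtain ⟨C, hC⟩ := hΩ.isCompact_closure.exists_bound_of_continuousOn hF
  exact ⟨C, fun x hx => (hE hx) ▸ hC x (subset_closure hx)⟩

lemma HasBoundedDerivatives.congr (hΩ : IsOpen Ω) (hb : HasBoundedDerivatives Ω b)
    (h : EqOn c b Ω) : HasBoundedDerivatives Ω c := by
  refine ⟨hb.1.congr h, fun k => ?_⟩
  obtain ⟨C, hC⟩ := hb.2 k
  refine ⟨C, fun x hx => ?_⟩
  rw [(h.eventuallyEq_of_mem (hΩ.mem_nhds hx)).iteratedFDeriv ℝ k |>.eq_of_nhds]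
  exact hC x hx

lemma HasBoundedDerivatives.neg (hb : HasBoundedDerivatives Ω b) :
    HasBoundedDerivatives Ω (fun x => -b x) := by
  refine ⟨hb.1.neg, fun k => ?_⟩
  obtain ⟨C, hC⟩ := hb.2 k
  refine ⟨C, fun x hx => ?_⟩
  have : iteratedFDeriv ℝ k (fun x => -b x) x = -iteratedFDeriv ℝ k b x :=
    iteratedFDeriv_neg_apply
  rw [this, norm_neg]
  exact hC x hx

lemma HasBoundedDerivatives.add (hΩ : IsOpen Ω) (hb : HasBoundedDerivatives Ω b)
    (hc : HasBoundedDerivatives Ω c) : HasBoundedDerivatives Ω (fun x => b x + c x) := by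
  refine ⟨hb.1.add hc.1, fun k => ?_⟩
  obtain ⟨C, hC⟩ := hb.2 k
  obtain ⟨D, hD⟩ := hc.2 k
  refine ⟨C + D, fun x hx => ?_⟩
  have hk : (k : WithTop ℕ∞) ≤ ((⊤ : ℕ∞) : WithTop ℕ∞) := mod_cast le_top
  have hadd : iteratedFDeriv ℝ k (fun x => b x + c x) x = _ := iteratedFDeriv_add_apply ((hb.1.contDiffAt (hΩ.mem_nhds hx)).of_le hk)
    ((hc.1.contDiffAt (hΩ.mem_nhds hx)).of_le hk)
  rw [hadd]
  exact (norm_add_le _ _).trans (add_le_add (hC x hx) (hD x hx))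

lemma HasBoundedDerivatives.sum (hΩ : IsOpen Ω) {ι : Type*} (s : Finset ι)
    {g : ι → EuclideanSpace ℝ (Fin n) → ℝ} (hg : ∀ i ∈ s, HasBoundedDerivatives Ω (g i)) :
    HasBoundedDerivatives Ω (fun x => ∑ i ∈ s, g i x) := by
  classical
  induction s using Finset.induction_on with
  | empty =>
    simp only [Finset.sum_empty]
    exact ⟨contDiffOn_const, fun k => ⟨0, fun x _ => by simp [iteratedFDeriv_fun_zero]⟩⟩
  | insert i s hi ih =>
    simp only [Finset.sum_insert hi]
    exact (hg i (Finset.mem_insert_self i s)).add hΩ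
      (ih fun k hk => hg k (Finset.mem_insert_of_mem hk))

lemma HasBoundedDerivatives.fderiv_apply (hΩ : IsOpen Ω) (hb : HasBoundedDerivatives Ω b)
    (v : EuclideanSpace ℝ (Fin n)) : HasBoundedDerivatives Ω (fun x => fderiv ℝ b x v) := by
  refine ⟨contDiffOn_fderiv_apply hΩ hb.1 v, fun k => ?_⟩
  obtain ⟨C, hC⟩ := hb.2 (k + 1)
  set L : (EuclideanSpace ℝ (Fin n) →L[ℝ] ℝ) →L[ℝ] ℝ := ContinuousLinearMap.apply ℝ ℝ v
  refine ⟨‖L‖ * C, fun x hx => ?_⟩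
  have hd : ContDiffAt ℝ ∞ (fderiv ℝ b) x :=
    (hb.1.contDiffAt (hΩ.mem_nhds hx)).fderiv_right (by simp)
  have hk : (k : WithTop ℕ∞) ≤ ((⊤ : ℕ∞) : WithTop ℕ∞) := mod_cast le_top
  refine (L.norm_iteratedFDeriv_comp_left hd hk).trans ?_
  rw [norm_iteratedFDeriv_fderiv]
  exact mul_le_mul_of_nonneg_left (hC x hx) (norm_nonneg _)

lemma HasBoundedDerivatives.laplacian (hΩ : IsOpen Ω) (hb : HasBoundedDerivatives Ω b) :
    HasBoundedDerivatives Ω (Δ b) :=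
  (HasBoundedDerivatives.sum hΩ Finset.univ fun i _ =>
    (hb.fderiv_apply hΩ (EuclideanSpace.single i 1)).fderiv_apply hΩ
      (EuclideanSpace.single i 1)).congr hΩ fun _ hx => laplacian_eq_sum hΩ hb.1 hx

lemma HasBoundedDerivatives.negLaplacianAddOne (hΩ : IsOpen Ω) (hb : HasBoundedDerivatives Ω b) :
    HasBoundedDerivatives Ω (negLaplacianAddOne b) :=
  (hb.laplacian hΩ).neg.add hΩ hb

lemma HasBoundedDerivatives.exists_bound (hb : HasBoundedDerivatives Ω b) :
    ∃ C, ∀ x ∈ Ω, |b x| ≤ C := by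
  obtain ⟨C, hC⟩ := hb.2 0
  exact ⟨C, fun x hx => by simpa using hC x hx⟩

lemma HasBoundedDerivatives.exists_bound_gradient (hb : HasBoundedDerivatives Ω b) :
    ∃ C, ∀ x ∈ Ω, ‖gradient b x‖ ≤ C := by
  obtain ⟨C, hC⟩ := hb.2 1
  exact ⟨C, fun x hx => by simpa [gradient, norm_iteratedFDeriv_one] using hC x hx⟩

/-- A limit of points of the superlevel set cannot be on `∂Ω`, where `b` tends to 0; so the set is
closed, not merely closed in `Ω`. -/
lemma isCompact_superlevel (hΩ : IsOpen Ω) (hΩb : Bornology.IsBounded Ω)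
    (hb : ContinuousOn b Ω) (h0 : ∀ y ∈ frontier Ω, Tendsto b (𝓝[Ω] y) (𝓝 0)) {δ : ℝ}
    (hδ : 0 < δ) : IsCompact {x | x ∈ Ω ∧ δ ≤ |b x|} := by
  refine hΩb.isCompact_closure.of_isClosed_subset (isClosed_of_closure_subset fun y hy => ?_)
    fun x hx => subset_closure hx.1
  have hyΩ : y ∈ closure Ω := closure_mono (fun x hx => hx.1) hy
  have : (𝓝[{x | x ∈ Ω ∧ δ ≤ |b x|}] y).NeBot := mem_closure_iff_nhdsWithin_neBot.1 hy
  have hle : 𝓝[{x | x ∈ Ω ∧ δ ≤ |b x|}] y ≤ 𝓝[Ω] y := nhdsWithin_mono y fun x hx => hx.1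
  have hev : ∀ᶠ x in 𝓝[{x | x ∈ Ω ∧ δ ≤ |b x|}] y, δ ≤ |b x| := by
    filter_upwards [self_mem_nhdsWithin] with x hx using hx.2
  by_cases hy' : y ∈ Ω
  · exact ⟨hy', ge_of_tendsto ((hb y hy').abs.mono_left hle) hev⟩
  · have := ge_of_tendsto ((h0 y (hΩ.frontier_eq ▸ ⟨hyΩ, hy'⟩)).abs.mono_left hle) hev
    rw [abs_zero] at this
    exact absurd this hδ.not_ge

lemma HasBoundedDerivatives.exists_isProfile (hΩ : IsOpen Ω) (hΩb : Bornology.IsBounded Ω)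
    (hb : HasBoundedDerivatives Ω b) (h0 : ∀ y ∈ frontier Ω, Tendsto b (𝓝[Ω] y) (𝓝 0)) :
    ∃ M, 0 ≤ M ∧ IsProfile Ω b M := by
  obtain ⟨A, hA⟩ := hb.exists_bound
  obtain ⟨B, hB⟩ := hb.exists_bound_gradient
  obtain ⟨C, hC⟩ := (hb.laplacian hΩ).exists_bound
  have hM : ∀ {a t : ℝ}, a ≤ t → (t = A ∨ t = B ∨ t = C) → a ≤ max 0 (max A (max B C)) := by
    rintro a t h (rfl | rfl | rfl) <;> simp [h]
  exact ⟨max 0 (max A (max B C)), le_max_left _ _, hb.1, fun x hx => hM (hA x hx) (by simp),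
    fun x hx => hM (hB x hx) (by simp), fun x hx => hM (hC x hx) (by simp),
    fun δ hδ => isCompact_superlevel hΩ hΩb hb.1.continuousOn h0 hδ⟩

lemma HasBoundedDerivatives.memLp_indicator (hΩ : IsOpen Ω) (hΩb : Bornology.IsBounded Ω)
    (hb : HasBoundedDerivatives Ω b) : MemLp (Ω.indicator b) 2 volume := by
  obtain ⟨C, hC⟩ := hb.exists_bound
  refine memLp_two_of_bound (C := C) hΩ.measurableSet hΩb.measure_lt_top.ne
    ((aestronglyMeasurable_indicator_iff hΩ.measurableSet).2
      (hb.1.continuousOn.aestronglyMeasurable hΩ.measurableSet)) (fun x hx => ?_) fun x hx => indicator_of_notMem hx b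
  rw [indicator_of_mem hx]
  exact hC x hx

end BoundedDerivatives

/-! ### The second-order condition at a maximum. -/

/-- The Laplacian is nonpositive at an interior maximum. -/
lemma laplacian_nonpos_of_isLocalMax {Ω : Set (EuclideanSpace ℝ (Fin n))} (hΩ : IsOpen Ω)
    {b : EuclideanSpace ℝ (Fin n) → ℝ} (hb : ContDiffOn ℝ ∞ b Ω) {x : EuclideanSpace ℝ (Fin n)}
    (hx : x ∈ Ω) (hmax : IsLocalMax b x) : (Δ b) x ≤ 0 := by
  rw [laplacian_eq_sum hΩ hb hx]
  refine Finset.sum_nonpos fun i _ => ?_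
  set v : EuclideanSpace ℝ (Fin n) := EuclideanSpace.single i 1
  by_contra! hpos
  set g : ℝ → ℝ := fun t => b (x + t • v)
  have hline : ∀ t, HasDerivAt (fun t : ℝ => x + t • v) v t := fun t => by
    simpa using ((hasDerivAt_id t).smul_const v).const_add x
  have hlim : Tendsto (fun t : ℝ => x + t • v) (𝓝 0) (𝓝 x) := by
    simpa using (hline 0).continuousAt.tendsto
  have hd : ∀ᶠ t in 𝓝 (0 : ℝ), HasDerivAt g (fderiv ℝ b (x + t • v) v) t := by
    filter_upwards [hlim.eventually (hΩ.mem_nhds hx)] with t ht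
    exact (((hb.contDiffAt (hΩ.mem_nhds ht)).differentiableAt (by simp)).hasFDerivAt).comp_hasDerivAt
      t (hline t)
  have hd1 : deriv g =ᶠ[𝓝 0] fun t => fderiv ℝ b (x + t • v) v := hd.mono fun t ht => ht.deriv
  have hd2 : deriv (deriv g) 0 = fderiv ℝ (fun y => fderiv ℝ b y v) x v := by
    rw [hd1.deriv_eq]
    have h2 : DifferentiableAt ℝ (fun y => fderiv ℝ b y v) (x + (0 : ℝ) • v) := by
      rw [zero_smul, add_zero]
      exact ((contDiffOn_fderiv_apply hΩ hb v).contDiffAt (hΩ.mem_nhds hx)).differentiableAt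
        (by simp)
    have := (h2.hasFDerivAt.comp_hasDerivAt (0 : ℝ) (hline 0)).deriv
    simpa [Function.comp_def] using this
  have hgmax : IsLocalMax g 0 := by
    have : ∀ᶠ t in 𝓝 (0 : ℝ), b (x + t • v) ≤ b x := hlim.eventually hmax
    simpa [IsLocalMax, IsMaxFilter, g] using this
  -- A positive second derivative at a critical point makes it a local minimum as well; the
  -- restriction to the line is then locally constant, so its second derivative is zero.
  have hgmin : IsLocalMin g 0 := isLocalMin_of_deriv_deriv_pos (hd2 ▸ hpos) hgmax.deriv_eq_zero
    hd.self_of_nhds.continuousAt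
  have hconst : g =ᶠ[𝓝 0] fun _ => g 0 := by
    filter_upwards [hgmax, hgmin] with t h1 h2 using le_antisymm h1 h2
  have h0 : deriv (deriv g) 0 = 0 := by
    rw [hconst.deriv.deriv_eq]
    simp
  rw [← hd2, h0] at hpos
  exact lt_irrefl _ hpos

/-! ### The distributional equation and its consequence for `w`. -/

section Classical

variable {U : Set (EuclideanSpace ℝ (Fin n))} {φ b : EuclideanSpace ℝ (Fin n) → ℝ}

/-- Green's identity against a test function. -/
lemma IsTestFunction.setIntegral_mul_laplacian (hφ : IsTestFunction U φ) (hU : IsOpen U)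
    (hb : ContDiffOn ℝ ∞ b U) : ∫ x in U, b x * (Δ φ) x = ∫ x in U, (Δ b) x * φ x := by
  have hi1 : IntegrableOn (fun x => b x * (Δ φ) x) U := by
    simpa [mul_comm] using (hφ.laplacian.integrable_mul hU hb.continuousOn).integrableOn
  have hi2 : IntegrableOn (fun x => (Δ b) x * φ x) U := by
    simpa [mul_comm] using
      (hφ.integrable_mul hU (contDiffOn_laplacian hU hb).continuousOn).integrableOn
  obtain ⟨hI, h1⟩ := hφ.setIntegral_inner_gradient hU hb
  have h2 := (hφ.setIntegral_mul_inner_gradient hU (a := fun _ => 1) contDiffOn_const hb).2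
  have hI' : IntegrableOn (fun x => inner ℝ (gradient b x) (gradient φ x)) U := by
    refine (hI.sub hi1).congr (Eventually.of_forall fun x => ?_)
    simp
  have hg : gradient (fun _ : EuclideanSpace ℝ (Fin n) => (1 : ℝ)) = 0 := by
    funext x
    simp [gradient]
  simp only [one_mul, hg, Pi.zero_apply, inner_zero_left, add_zero] at h2
  rw [integral_add hI' hi1] at h1
  rw [integral_add hI' hi2] at h2
  linarith

/-- A weak solution satisfies the biharmonic equation in the sense of distributions. -/
lemma IsSolution.setIntegral_mul_laplacian (hU : IsOpen U) {f u : EuclideanSpace ℝ (Fin n) → ℝ}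
    {a : ScalarL2 n} (ha : a =ᵐ[volume.restrict U] f) (hu : IsSolution U f u)
    (hφ : IsTestFunction U φ) :
    ∫ x in U, u x * (Δ (Δ φ)) x = ∫ x in U, f x * φ x := by
  obtain ⟨p, hp, q, hq, hpu, h1, h2⟩ := (isSolution_iff hU.measurableSet ha).1 hu
  -- Each Dirichlet problem moves one Laplacian onto the test function. The two uses, with `Δφ` and
  -- then `φ`, give the fourth-order identity.
  have key : ∀ {ψ : EuclideanSpace ℝ (Fin n) → ℝ} (hψ : IsTestFunction U ψ) {r : PairL2 n}
      {c : ScalarL2 n}, r ∈ H10 U → (∀ t ∈ H10 U, -inner ℝ r.snd t.snd = inner ℝ c t.fst) →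
      inner ℝ r.fst (hψ.laplacian.memLp.toLp (Δ ψ)) = inner ℝ c (hψ.memLp.toLp ψ) := by
    intro ψ hψ r c hr h
    have := h _ (testPairs_le_H10 U hψ.mkPair_mem)
    rw [← neg_eq_iff_eq_neg.2 (inner_snd_gradient hψ hr)]
    exact this
  have h3 : inner ℝ p.fst (hφ.laplacian.laplacian.memLp.toLp (Δ (Δ φ))) =
      inner ℝ a (hφ.memLp.toLp φ) := (key hφ.laplacian hp h1).trans (key hφ hq h2)
  have hz : ∀ {ψ : EuclideanSpace ℝ (Fin n) → ℝ} (hψ : IsTestFunction U ψ) (c : ScalarL2 n),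
      inner ℝ c (hψ.memLp.toLp ψ) = ∫ x in U, c x * ψ x := by
    intro ψ hψ c
    rw [inner_eq_integral_of_ae_eq EventuallyEq.rfl hψ.memLp.coeFn_toLp,
      setIntegral_eq_integral_of_forall_compl_eq_zero]
    · simp [mul_comm]
    · intro x hx
      rw [hψ.eq_zero_of_notMem hx, mul_zero]
  rw [hz hφ.laplacian.laplacian, hz hφ] at h3
  rw [integral_congr_ae (g := fun x => p.fst x * (Δ (Δ φ)) x), h3]
  · exact integral_congr_ae (ha.mono fun x hx => by simp only [hx])
  · exact (ae_restrict_of_ae hpu).mono fun x hx => by simp only [hx]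

/-- If the classical function `w` is a solution on `U` for the right-hand side
`(-Δ + 1)(-Δ + 1)w`, then `w = 2(-Δ + 1)w` on `U`. -/
lemma ae_eq_of_isSolution (hU : IsOpen U) {w u : EuclideanSpace ℝ (Fin n) → ℝ}
    (hw : ContDiffOn ℝ ∞ w U) {a : ScalarL2 n}
    (ha : a =ᵐ[volume.restrict U] negLaplacianAddOne (negLaplacianAddOne w))
    (hu : IsSolution U (negLaplacianAddOne (negLaplacianAddOne w)) u)
    (huw : u =ᵐ[volume.restrict U] w) :
    ∀ᵐ x, x ∈ U → w x = 2 * negLaplacianAddOne w x := by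
  set z := negLaplacianAddOne w with hz
  have hzc : ContDiffOn ℝ ∞ z U := (contDiffOn_laplacian hU hw).neg.add hw
  have hfc : ContDiffOn ℝ ∞ (negLaplacianAddOne z) U := (contDiffOn_laplacian hU hzc).neg.add hzc
  have hc : ContinuousOn (fun x => w x - 2 * z x) U :=
    hw.continuousOn.sub (continuousOn_const.mul hzc.continuousOn)
  have := hU.ae_eq_zero_of_integral_contDiff_smul_eq_zero (μ := volume)
    (hc.locallyIntegrableOn hU.measurableSet) (fun φ h1 h2 h3 => ?_)
  · filter_upwards [this] with x hx hxU
    linarith [hx hxU]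
  · have hφ : IsTestFunction U φ := ⟨h1, h2, h3⟩
    have hI : ∀ {c : EuclideanSpace ℝ (Fin n) → ℝ}, ContDiffOn ℝ ∞ c U → ∀ {ψ},
        IsTestFunction U ψ → IntegrableOn (fun x => c x * ψ x) U := fun hc _ hψ => by
      simpa [mul_comm] using (hψ.integrable_mul hU hc.continuousOn).integrableOn
    have e1 := hu.setIntegral_mul_laplacian hU ha hφ
    have hs : IntegrableOn (fun x => (Δ w) x * φ x - (Δ z) x * φ x) U :=
      (hI (contDiffOn_laplacian hU hw) hφ).sub (hI (contDiffOn_laplacian hU hzc) hφ)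
    -- Only `Δw = w - z` is used. After moving one more Laplacian back, the equation reads `Δw - Δz
    -- = f = -Δz + z`, so `Δz` cancels and `w = 2z` remains.
    have hΔ : ∫ x in U, (Δ w) x * (Δ φ) x = ∫ x in U, (w x * (Δ φ) x - z x * (Δ φ) x) := by
      refine integral_congr_ae (Eventually.of_forall fun x => ?_)
      simp only [hz, negLaplacianAddOne]
      ring
    rw [integral_congr_ae (g := fun x => w x * (Δ (Δ φ)) x)
      (huw.mono fun x hx => by simp only [hx]), hφ.laplacian.setIntegral_mul_laplacian hU hw,
      hΔ,
      integral_sub (hI hw hφ.laplacian) (hI hzc hφ.laplacian),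
      hφ.setIntegral_mul_laplacian hU hw, hφ.setIntegral_mul_laplacian hU hzc,
      ← integral_sub (hI (contDiffOn_laplacian hU hw) hφ) (hI (contDiffOn_laplacian hU hzc) hφ),
      ← sub_eq_zero, ← integral_sub hs (hI hfc hφ)] at e1
    rw [← e1, ← setIntegral_eq_integral_of_forall_compl_eq_zero (s := U)]
    · refine integral_congr_ae (Eventually.of_forall fun x => ?_)
      simp only [hz, negLaplacianAddOne, smul_eq_mul]
      ring
    · intro x hx
      rw [hφ.eq_zero_of_notMem hx, zero_smul]

end Classical

/-! ### The infimum of the cost and its nonattainment. -/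

section Minimization

variable {Ω U : Set (EuclideanSpace ℝ (Fin n))} {w f u : EuclideanSpace ℝ (Fin n) → ℝ}

lemma ae_eq_restrict_of_indicator {b : EuclideanSpace ℝ (Fin n) → ℝ} {a : ScalarL2 n}
    (ha : a =ᵐ[volume] Ω.indicator b) (hU : IsOpen U) (hUΩ : U ⊆ Ω) :
    a =ᵐ[volume.restrict U] b := by
  filter_upwards [ae_restrict_of_ae ha, ae_restrict_mem hU.measurableSet] with x hx hxU
  rw [hx, indicator_of_mem (hUΩ hxU)]

lemma IsSolution.memLp (hu : IsSolution U f u) : MemLp u 2 volume :=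
  hu.choose_spec.choose_spec.choose_spec.1.1

lemma IsSolution.ae_eq_zero (hU : IsOpen U) (hu : IsSolution U f u) :
    ∀ᵐ x, x ∉ U → u x = 0 := by
  obtain ⟨Gu, v, Gv, h, -⟩ := hu
  obtain ⟨p, hp, hpu, -⟩ := inH10_iff.1 h
  filter_upwards [(ae_restrict_iff' hU.measurableSet.compl).1
    (ae_eq_zero_of_mem_H10 hU.measurableSet hp).1, hpu] with x h1 h2 hx
  rw [← h2]
  exact h1 hx

lemma cost_eq_zero_iff (hu : MemLp u 2 volume) (hΩ : IsOpen Ω)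
    (hw : MemLp (Ω.indicator w) 2 volume) :
    cost Ω (fun x s => (s - w x) ^ 2) u = 0 ↔ u =ᵐ[volume.restrict Ω] w := by
  have hi : IntegrableOn (fun x => (u x - w x) ^ 2) Ω := by
    refine IntegrableOn.congr_fun (f := fun x => (u x - Ω.indicator w x) ^ 2)
      (hu.sub hw).integrable_sq.integrableOn (fun x hx => ?_) hΩ.measurableSet
    simp only [indicator_of_mem hx]
  rw [cost, integral_eq_zero_iff_of_nonneg (fun x => sq_nonneg _) hi]
  refine ⟨fun h => h.mono fun x hx => ?_, fun h => h.mono fun x hx => ?_⟩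
  · simpa [sub_eq_zero] using hx
  · simp [hx]

lemma cost_le_norm_sub_sq (hΩ : IsOpen Ω) {p H : ScalarL2 n} (hp : p =ᵐ[volume] u)
    (hH : H =ᵐ[volume] Ω.indicator w) :
    cost Ω (fun x s => (s - w x) ^ 2) u ≤ ‖p - H‖ ^ 2 := by
  have hi : Integrable (fun x => ‖(p - H) x‖ ^ 2) volume := (Lp.memLp (p - H)).norm.integrable_sq
  rw [norm_sq_eq_integral]
  refine le_of_eq_of_le ?_ (setIntegral_le_integral (s := Ω) hi
    (Eventually.of_forall fun x => sq_nonneg _))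
  refine integral_congr_ae ?_
  filter_upwards [ae_restrict_of_ae hp, ae_restrict_of_ae (Lp.coeFn_sub p H),
    ae_eq_restrict_of_indicator hH hΩ subset_rfl] with x h1 h2 h3
  rw [h2, Pi.sub_apply, h1, h3, Real.norm_eq_abs, sq_abs]

/-- A positive function vanishing on the boundary is not a solution on any open subset. -/
lemma not_ae_eq_of_isSolution (hΩ : IsOpen Ω) (hΩb : Bornology.IsBounded Ω) (hne : Ω.Nonempty)
    (hw : ContDiffOn ℝ ∞ w Ω) (hwc : ContinuousOn w (closure Ω)) (hpos : ∀ x ∈ Ω, 0 < w x)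
    (h0 : ∀ y ∈ frontier Ω, w y = 0) {a : ScalarL2 n}
    (ha : a =ᵐ[volume] Ω.indicator (negLaplacianAddOne (negLaplacianAddOne w)))
    (hU : IsOpen U) (hUΩ : U ⊆ Ω)
    (hu : IsSolution U (negLaplacianAddOne (negLaplacianAddOne w)) u) :
    ¬ u =ᵐ[volume.restrict Ω] w := by
  intro huw
  have h1 := ae_eq_of_isSolution hU (hw.mono hUΩ) (ae_eq_restrict_of_indicator ha hU hUΩ) hu
    (ae_restrict_of_ae_restrict_of_subset hUΩ huw)
  have hzc : ContDiffOn ℝ ∞ (negLaplacianAddOne w) Ω := (contDiffOn_laplacian hΩ hw).neg.add hw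
  -- Almost no point of `Ω` is outside `U`, since there `u = 0` whereas `w > 0`; so the identity on
  -- `U` holds almost everywhere in `Ω`, and by continuity everywhere.
  have h2 : w =ᵐ[volume.restrict Ω] fun x => 2 * negLaplacianAddOne w x := by
    filter_upwards [ae_restrict_of_ae h1, huw, ae_restrict_mem hΩ.measurableSet,
      ae_restrict_of_ae (hu.ae_eq_zero hU)] with x h1 h2 h3 h4
    refine h1 (by_contra fun hx => ?_)
    exact (hpos x h3).ne (by rw [← h2, h4 hx])
  have h3 : EqOn w (fun x => 2 * negLaplacianAddOne w x) Ω :=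
    Measure.eqOn_open_of_ae_eq h2 hΩ hw.continuousOn (continuousOn_const.mul hzc.continuousOn)
  obtain ⟨x, hx, hmax⟩ := hΩb.isCompact_closure.exists_isMaxOn hne.closure hwc
  obtain ⟨y, hy⟩ := hne
  have hwx : 0 < w x := (hpos y hy).trans_le (hmax (subset_closure hy))
  have hxΩ : x ∈ Ω := by
    by_contra hx'
    exact hwx.ne (h0 x (hΩ.frontier_eq ▸ ⟨hx, hx'⟩)).symm
  have hΔ := laplacian_nonpos_of_isLocalMax hΩ hw hxΩ
    (hmax.isLocalMax (mem_of_superset (hΩ.mem_nhds hxΩ) subset_closure))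
  have := h3 hxΩ
  simp only [negLaplacianAddOne] at this
  linarith

/-- There are open subsets of `Ω` whose solutions approximate `w` in `L²`. -/
lemma exists_isSolution_cost_le (hΩ : IsOpen Ω) (hΩb : Bornology.IsBounded Ω) {i j : Fin n}
    (hij : i ≠ j) (hw : HasBoundedDerivatives Ω w)
    (h0 : ∀ y ∈ frontier Ω, Tendsto w (𝓝[Ω] y) (𝓝 0))
    (h0' : ∀ y ∈ frontier Ω, Tendsto (negLaplacianAddOne w) (𝓝[Ω] y) (𝓝 0))
    {R : ℝ} (hR0 : 0 ≤ R) (hR : ∀ x ∈ Ω, |x i| ≤ R) {a : ScalarL2 n}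
    (ha : a =ᵐ[volume] Ω.indicator (negLaplacianAddOne (negLaplacianAddOne w)))
    {ε : ℝ} (hε : 0 < ε) :
    ∃ U u, IsOpen U ∧ U ⊆ Ω ∧ IsSolution U (negLaplacianAddOne (negLaplacianAddOne w)) u ∧
      cost Ω (fun x s => (s - w x) ^ 2) u ≤ ε := by
  set z := negLaplacianAddOne w with hzdef
  have hz : HasBoundedDerivatives Ω z := hw.negLaplacianAddOne hΩ
  obtain ⟨A, hA0, hA⟩ := hw.exists_isProfile hΩ hΩb h0
  -- The profile is `-z` because `q` represents `Δu`, whose limit is `-z`.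
  obtain ⟨B, hB0, hB⟩ := hz.neg.exists_isProfile hΩ hΩb
    fun y hy => by simpa using (h0' y hy).neg
  have hΩfin : volume Ω ≠ ⊤ := hΩb.measure_lt_top.ne
  set K := (4 * R ^ 2 + 4 * R + 1) with hK
  have hK0 : 0 ≤ K := by positivity
  -- The first Dirichlet problem has error `K B d`; it enters the second as a perturbation of the
  -- datum, multiplied by `4R²`, and adds to the new error `K A d`. Dividing by `C + 1` below covers
  -- the case `C = 0`.
  set C := 4 * R ^ 2 * (K * B) + K * A with hC
  have hC0 : 0 ≤ C := by positivity
  obtain ⟨U, θ, hθ, hd⟩ := exists_isCorrector hΩ hΩb hij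
    (ε := √ε / (C + 1)) (by positivity)
  have haU := ae_eq_restrict_of_indicator ha hθ.isOpen hθ.subset
  obtain ⟨u, hu, -⟩ := exists_unique_isSolution i hR0 (fun x hx => hR x (hθ.subset hx))
    hθ.isOpen.measurableSet haU
  refine ⟨U, u, hθ.isOpen, hθ.subset, hu, ?_⟩
  obtain ⟨p, hp, q, hq, hpu, h1, h2⟩ := (isSolution_iff hθ.isOpen.measurableSet haU).1 hu
  set H := (hw.memLp_indicator hΩ hΩb).toLp _ with hHdef
  set Z := (hz.memLp_indicator hΩ hΩb).toLp _ with hZdef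
  set d := ‖hθ.memLp.toLp _‖ with hddef
  have hH : H =ᵐ[volume] Ω.indicator w := MemLp.coeFn_toLp _
  have hZ : Z =ᵐ[volume] Ω.indicator z := MemLp.coeFn_toLp _
  have e1 : ‖q.fst - -Z‖ ≤ K * B * d := by
    have := hθ.norm_sub_le hB hΩfin hB0 i hR0 hR hq (a := -a) (g := -a) (H := -Z)
      (fun t ht => by rw [inner_neg_left, ← h2 t ht, neg_neg]) ?_ ?_
    · rwa [sub_self, norm_zero, mul_zero, zero_add] at this
    · filter_upwards [ha, Lp.coeFn_neg a] with x h1 h2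
      have hn : (Δ fun x => -z x) x = -(Δ z) x := by
        have := congrFun (InnerProductSpace.laplacian_neg (f := z)) x
        exact this
      rw [h2, Pi.neg_apply, h1]
      by_cases hx : x ∈ Ω
      · simp only [indicator_of_mem hx, hn, negLaplacianAddOne]
        ring
      · simp [indicator_of_notMem hx]
    · filter_upwards [hZ, Lp.coeFn_neg Z] with x h1 h2
      rw [h2, Pi.neg_apply, h1]
      by_cases hx : x ∈ Ω <;> simp [hx]
  have e2 : ‖p.fst - H‖ ≤ 4 * R ^ 2 * ‖q.fst - -Z‖ + K * A * d := by
    have := hθ.norm_sub_le hA hΩfin hA0 i hR0 hR hp (a := -q.fst) (g := Z) (H := H)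
      (fun t ht => by rw [inner_neg_left, ← h1 t ht, neg_neg]) hZ hH
    rwa [show -q.fst - Z = -(q.fst - -Z) by abel, norm_neg] at this
  have e3 : ‖p.fst - H‖ ≤ √ε := by
    calc ‖p.fst - H‖ ≤ 4 * R ^ 2 * (K * B * d) + K * A * d :=
          e2.trans (by gcongr)
      _ = C * d := by rw [hC]; ring
      _ ≤ C * (√ε / (C + 1)) := by gcongr
      _ = √ε * (C / (C + 1)) := by ring
      _ ≤ √ε * 1 := by
          gcongr
          exact (div_le_one (by positivity)).2 (by linarith)
      _ = √ε := mul_one _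
  calc cost Ω (fun x s => (s - w x) ^ 2) u ≤ ‖p.fst - H‖ ^ 2 := cost_le_norm_sub_sq hΩ hpu hH
    _ ≤ √ε ^ 2 := by gcongr
    _ = ε := Real.sq_sqrt hε.le

end Minimization

end SimplySupported

end

/-! ### Assembly of the main theorem. -/

theorem mainTheorem6 (n : ℕ) (hn : 2 ≤ n)
    (Ω : Set (EuclideanSpace ℝ (Fin n)))
    (hΩ_open : IsOpen Ω) (hΩ_bdd : Bornology.IsBounded Ω) (hΩ_ne : Ω.Nonempty)
    (hΩ_smooth : SimplySupported.HasSmoothBoundary Ω)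
    (w : EuclideanSpace ℝ (Fin n) → ℝ)
    (hw_smooth : SimplySupported.SmoothUpToBoundary Ω w)
    (hw_pos : ∀ x ∈ Ω, 0 < w x)
    (hw_bdry : ∀ y ∈ frontier Ω, w y = 0)
    -- the continuous extension of `Δw` to `∂Ω` vanishes there
    (hΔw_bdry : ∀ y ∈ frontier Ω, Tendsto (Δ w) (𝓝[Ω] y) (𝓝 0))
    (z f : EuclideanSpace ℝ (Fin n) → ℝ)
    (hz : z = SimplySupported.negLaplacianAddOne w)
    (hf : f = SimplySupported.negLaplacianAddOne z)
    (j : EuclideanSpace ℝ (Fin n) → ℝ → ℝ)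
    (hj : j = fun x s => (s - w x) ^ 2) :
    -- each open `U ⊆ Ω` has exactly one solution `u_U`, up to null sets
    (∀ U : Set (EuclideanSpace ℝ (Fin n)), IsOpen U → U ⊆ Ω →
      ∃ u, SimplySupported.IsSolution U f u ∧
        ∀ u', SimplySupported.IsSolution U f u' → u' =ᵐ[volume] u) ∧
    -- the cost of `u_U` vanishes exactly when `u_U = w` almost everywhere in `Ω`
    (∀ (U : Set (EuclideanSpace ℝ (Fin n))) (u : EuclideanSpace ℝ (Fin n) → ℝ),
      IsOpen U → U ⊆ Ω → SimplySupported.IsSolution U f u →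
        (SimplySupported.cost Ω j u = 0 ↔ u =ᵐ[volume.restrict Ω] w)) ∧
    -- `w` is not `u_U`, for any open `U ⊆ Ω`
    (∀ (U : Set (EuclideanSpace ℝ (Fin n))) (u : EuclideanSpace ℝ (Fin n) → ℝ),
      IsOpen U → U ⊆ Ω → SimplySupported.IsSolution U f u → ¬ u =ᵐ[volume.restrict Ω] w) ∧
    -- the infimum of the cost is zero, and no domain attains it
    IsGLB (SimplySupported.costValues Ω f j) 0 ∧
    ¬ ∃ U : Set (EuclideanSpace ℝ (Fin n)), SimplySupported.IsOptimalDomain Ω f j U := by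
  subst hz hf hj
  have hw := hw_smooth.hasBoundedDerivatives hΩ_bdd
  have hz := hw.negLaplacianAddOne hΩ_open
  have hf := hz.negLaplacianAddOne hΩ_open
  have hmw := hw.memLp_indicator hΩ_open hΩ_bdd
  have ha := (hf.memLp_indicator hΩ_open hΩ_bdd).coeFn_toLp
  set a := (hf.memLp_indicator hΩ_open hΩ_bdd).toLp _
  -- Two distinct coordinates span the plane of the logarithmic potentials; this is where `2 ≤ n`
  -- enters.
  have hij : (⟨0, by omega⟩ : Fin n) ≠ ⟨1, by omega⟩ := by simp
  obtain ⟨R, hR0, hR⟩ := hΩ_bdd.exists_pos_norm_le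
  have hRi : ∀ x ∈ Ω, |x (⟨0, by omega⟩ : Fin n)| ≤ R := fun x hx =>
    (PiLp.norm_apply_le x _).trans (hR x hx)
  have h0 : ∀ y ∈ frontier Ω, Tendsto w (𝓝[Ω] y) (𝓝 0) := fun y hy => by
    have := (hw_smooth.2.1 y (frontier_subset_closure hy)).mono subset_closure
    rwa [ContinuousWithinAt, hw_bdry y hy] at this
  have h0' : ∀ y ∈ frontier Ω,
      Tendsto (SimplySupported.negLaplacianAddOne w) (𝓝[Ω] y) (𝓝 0) := fun y hy => by
    have := (hΔw_bdry y hy).neg.add (h0 y hy)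
    rwa [neg_zero, add_zero] at this
  have hnot := fun (U : Set (EuclideanSpace ℝ (Fin n))) (u : EuclideanSpace ℝ (Fin n) → ℝ)
    (hU : IsOpen U) (hUΩ : U ⊆ Ω)
    (hu : SimplySupported.IsSolution U (SimplySupported.negLaplacianAddOne
      (SimplySupported.negLaplacianAddOne w)) u) =>
    SimplySupported.not_ae_eq_of_isSolution hΩ_open hΩ_bdd hΩ_ne hw.1 hw_smooth.2.1 hw_pos hw_bdry
      ha hU hUΩ hu
  have hzero := fun (U : Set (EuclideanSpace ℝ (Fin n))) (u : EuclideanSpace ℝ (Fin n) → ℝ)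
    (hu : SimplySupported.IsSolution U (SimplySupported.negLaplacianAddOne
      (SimplySupported.negLaplacianAddOne w)) u) =>
    SimplySupported.cost_eq_zero_iff hu.memLp hΩ_open hmw
  have hnn : ∀ u, 0 ≤ SimplySupported.cost Ω (fun x s => (s - w x) ^ 2) u := fun u =>
    integral_nonneg fun x => sq_nonneg _
  have happrox := fun {ε : ℝ} (hε : 0 < ε) =>
    SimplySupported.exists_isSolution_cost_le hΩ_open hΩ_bdd hij hw h0 h0' hR0.le hRi ha hε
  refine ⟨fun U hU hUΩ => ?_, fun U u _ _ hu => hzero U u hu, hnot, ⟨?_, fun c hc => ?_⟩, ?_⟩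
  · exact SimplySupported.exists_unique_isSolution _ hR0.le (fun x hx => hRi x (hUΩ hx))
      hU.measurableSet (SimplySupported.ae_eq_restrict_of_indicator ha hU hUΩ)
  · rintro c ⟨U, u, -, -, -, rfl⟩
    exact hnn u
  · refine le_of_forall_pos_le_add fun ε hε => ?_
    obtain ⟨U, u, hU, hUΩ, hu, hle⟩ := happrox hε
    rw [zero_add]
    exact (hc ⟨U, u, hU, hUΩ, hu, rfl⟩).trans hle
  · rintro ⟨U, hU, hUΩ, u, hu, hmin⟩
    -- A minimizer would have cost at most every positive `ε`, hence zero, so its solution would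
    -- equal `w`.
    refine hnot U u hU hUΩ hu ((hzero U u hu).1 (le_antisymm ?_ (hnn u)))
    refine le_of_forall_pos_le_add fun ε hε => ?_
    obtain ⟨V, v, hV, hVΩ, hv, hle⟩ := happrox hε
    rw [zero_add]
    exact (hmin _ ⟨V, v, hV, hVΩ, hv, rfl⟩).trans hle
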